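/- Let $\mathfrak g$ be a finite-dimensional simple complex Lie algebra of type $A_n$ ($n\ge 1$) or $D_n$ ($n\ge 4$), with Cartan subalgebra $\mathfrak h$, simple roots $\alpha_1,\dots,\alpha_n$ numbered as usual (in type $D_n$, nodes $n-1$ and $n$ are the spin nodes), positive roots $R^+$, coroots $h_\alpha$ (with $h_i=h_{\alpha_i}$), root vectors $x_\alpha^\pm$ (with $x_i^\pm=x_{\alpha_i}^\pm$), weight lattice $P$ and dominant integral weights $P^+$. Put $\mathfrak n^+=\bigoplus_{\alpha\in R^+}\mathbb C x_\alpha^+$ and $\mathfrak g[t]=\mathfrak g\otimes\mathbb C[t]$. For $\lambda,\mu\in P^+$ let $V(\lambda,\mu)$ be the $\mathfrak g[t]$-module generated by an element $w_{\lambda,\mu}$ with defining relations $$\mathfrak n^+[t]w_{\lambda,\mu}=0,\quad (h\otimes t^r)w_{\lambda,\mu}=\delta_{r,0}(\lambda+\mu)(h)w_{\lambda,\mu}\ (h\in\mathfrak h,\ r\ge 0),\quad (x_i^-\otimes 1)^{(\lambda+\mu)(h_i)+1}w_{\lambda,\mu}=0\ (1\le i\le n),$$ $$(x_\alpha^-\otimes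 t^{\max\{\lambda(h_\alpha),\mu(h_\alpha)\}})w_{\lambda,\mu}=0\ (\alpha\in R^+).$$ A pair $(\lambda_1,\lambda_2)$ in $P^+\times P^+$ is called interlacing if $(\lambda_1+\lambda_2)(h_i)\le 1$ for all $i$ and, for $\{r,p\}=\{1,2\}$: (a) if $n\ge2$ and $\lambda_r(h_{n-1}+h_n)>0$, then $\lambda_p(h_{n-1}+h_n)=0$; (b) for all $1\le i<j\le n$ with $(i,j)\ne(n-1,n)$, if $\lambda_r(h_i)=1=\lambda_r(h_j)$, then $\lambda_p(h_s)=1$ for some $i<s<j$. Let $(\lambda_1,\lambda_2)\in P^+\times P^+$ be interlacing, let $\nu\in P^+$ (for instance $\nu=0$), and put $\nu_1=\lambda_1+\nu$, $\nu_2=\lambda_2+\nu$. Suppose that $\beta\in R^+$ is of minimal height among the positive roots with $$u_\beta:=(x_\beta^-\otimes t^{\lceil(\nu_1+\nu_2)(h_\beta)/2\rceil})w_{\nu_1,\nu_2}\ne 0 .$$ If $\nu_1(h_\beta)>\nu_2(h_\beta)$, then $\nu_1-\beta\in P^+$ and there is a surjective map of $\mathfrak g[t]$-modules from $V(\nu_1-\beta,\nu_2)$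 onto the submodule $\langle u_\beta\rangle=\mathbf U(\mathfrak g[t])u_\beta$ of $V(\nu_1,\nu_2)$, with $w_{\nu_1-\beta,\nu_2}\mapsto u_\beta$. Symmetrically, if $\nu_2(h_\beta)>\nu_1(h_\beta)$, then $\nu_2-\beta\in P^+$ and there is a surjective map of $\mathfrak g[t]$-modules from $V(\nu_1,\nu_2-\beta)$ onto $\langle u_\beta\rangle$, with $w_{\nu_1,\nu_2-\beta}\mapsto u_\beta$. -/

import Mathlib

open scoped TensorProduct Polynomial

noncomputable section

namespace CurrentAlg

open LieAlgebra LieAlgebra.IsKilling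

/-- The current algebra `𝔤[t] = ℂ[t] ⊗ 𝔤`, with bracket `[f ⊗ x, g ⊗ y] = fg ⊗ [x, y]`. -/
abbrev Current (𝔤 : Type*) [LieRing 𝔤] [LieAlgebra ℂ 𝔤] : Type _ := ℂ[X] ⊗[ℂ] 𝔤

/-- The universal enveloping algebra `U(𝔤[t])`. A `𝔤[t]`-module is a left `U(𝔤[t])`-module. -/
abbrev UCurrent (𝔤 : Type*) [LieRing 𝔤] [LieAlgebra ℂ 𝔤] : Type _ :=
  UniversalEnvelopingAlgebra ℂ (Current 𝔤)

/-- The element `x ⊗ t ^ r`, regarded in `U(𝔤[t])`. -/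
def cur {𝔤 : Type*} [LieRing 𝔤] [LieAlgebra ℂ 𝔤] (x : 𝔤) (r : ℕ) : UCurrent 𝔤 :=
  UniversalEnvelopingAlgebra.ι ℂ (((Polynomial.X : ℂ[X]) ^ r) ⊗ₜ[ℂ] x)

section Weights

variable {𝔤 : Type*} [LieRing 𝔤] [LieAlgebra ℂ 𝔤] [FiniteDimensional ℂ 𝔤] [IsKilling ℂ 𝔤]
  (H : LieSubalgebra ℂ 𝔤) [H.IsCartanSubalgebra]

/-- The weight lattice `P`: linear forms on the Cartan subalgebra that take integral values on all
coroots `h_α` (equivalently on the simple ones, so this is the span of the fundamental weights). -/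
def weightLattice : AddSubgroup (Module.Dual ℂ H) where
  carrier := {lam | ∀ α : H.root, ∃ z : ℤ, lam (coroot α.1) = z}
  zero_mem' := fun _ => ⟨0, by simp⟩
  add_mem' := by
    intro a c ha hc α
    obtain ⟨z, hz⟩ := ha α
    obtain ⟨y, hy⟩ := hc α
    exact ⟨z + y, by simp [hz, hy]⟩
  neg_mem' := by
    intro a ha α
    obtain ⟨z, hz⟩ := ha α
    exact ⟨-z, by simp [hz]⟩

variable {H}

/-- The integer `λ(h_α)`, for an integral weight `λ` and a root `α`. -/
def value (lam : weightLattice H) (α : H.root) : ℤ := (lam.2 α).choose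

theorem value_spec (lam : weightLattice H) (α : H.root) :
    (lam : Module.Dual ℂ H) (coroot α.1) = value lam α :=
  (lam.2 α).choose_spec

/-- A root, regarded as an element of the weight lattice. -/
def rootWeight (β : H.root) : weightLattice H :=
  ⟨(rootSystem H).root β, fun α =>
    ⟨(rootSystem H).pairingIn ℤ β α, by
      have h := (rootSystem H).algebraMap_pairingIn ℤ β α
      rw [rootSystem_pairing_apply] at h
      rw [rootSystem_root_apply]
      simpa using h.symm⟩⟩

/-- Dominance: `λ ∈ P⁺` iff `λ(h_i) ≥ 0` for all simple roots. -/
def IsDominant (b : (rootSystem H).Base) (lam : weightLattice H) : Prop :=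
  ∀ i ∈ b.support, 0 ≤ value lam i

/-- The generators of the left ideal of `U(𝔤[t])` that defines `V(λ, μ)`. Root vectors are taken
to be arbitrary elements of the (one-dimensional) root spaces. -/
inductive IsRelator (b : (rootSystem H).Base) (lam mu : weightLattice H) : UCurrent 𝔤 → Prop
  /-- `𝔫⁺[t] w = 0`. -/
  | raising (α : H.root) (hα : b.IsPos α) (x : 𝔤) (hx : x ∈ rootSpace H (α.1 : H → ℂ)) (r : ℕ) :
      IsRelator b lam mu (cur x r)
  /-- `(h ⊗ t ^ r) w = δ_{r,0} (λ + μ)(h) w`. -/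
  | cartan (h : H) (r : ℕ) :
      IsRelator b lam mu (cur (h : 𝔤) r -
        algebraMap ℂ (UCurrent 𝔤) (if r = 0 then ((lam + mu : weightLattice H) : Module.Dual ℂ H) h
          else 0))
  /-- `(x_i⁻ ⊗ 1) ^ ((λ + μ)(h_i) + 1) w = 0`. -/
  | integrable (i : H.root) (hi : i ∈ b.support) (x : 𝔤)
      (hx : x ∈ rootSpace H (-(i.1 : H → ℂ))) :
      IsRelator b lam mu (cur x 0 ^ ((value (lam + mu) i).toNat + 1))
  /-- `(x_α⁻ ⊗ t ^ max {λ(h_α), μ(h_α)}) w = 0`. -/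
  | lowering (α : H.root) (hα : b.IsPos α) (x : 𝔤)
      (hx : x ∈ rootSpace H (-(α.1 : H → ℂ))) :
      IsRelator b lam mu (cur x (max (value lam α) (value mu α)).toNat)

/-- The left ideal of `U(𝔤[t])` generated by the defining relations of `V(λ, μ)`. -/
def relIdeal (b : (rootSystem H).Base) (lam mu : weightLattice H) :
    Submodule (UCurrent 𝔤) (UCurrent 𝔤) :=
  Submodule.span (UCurrent 𝔤) {u | IsRelator b lam mu u}

/-- The cyclic `𝔤[t]`-module `V(λ, μ)` (of interest for dominant `λ` and `μ`). -/
abbrev V (b : (rootSystem H).Base) (lam mu : weightLattice H) : Type _ :=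
  UCurrent 𝔤 ⧸ relIdeal b lam mu

/-- The generator `w_{λ, μ}` of `V(λ, μ)`. -/
def gen (b : (rootSystem H).Base) (lam mu : weightLattice H) : V b lam mu :=
  (relIdeal b lam mu).mkQ 1

/-- The vector `(x ⊗ t ^ ⌈(λ + μ)(h_β) / 2⌉) w_{λ, μ}` of `V(λ, μ)`. -/
def midVector (b : (rootSystem H).Base) (lam mu : weightLattice H) (β : H.root) (x : 𝔤) :
    V b lam mu :=
  cur x ⌈(value (lam + mu) β : ℚ) / 2⌉₊ • gen b lam mu

/-- The simple roots are numbered by `e` as in the standard Dynkin diagram of type `A_n` (`n ≥ 1`)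
or `D_n` (`n ≥ 4`); in type `D_n` the last two nodes are the spin nodes. -/
def IsTypeAD (b : (rootSystem H).Base) {n : ℕ} (e : Fin n ≃ b.support) : Prop :=
  (1 ≤ n ∧ ∀ i j, b.cartanMatrix (e i) (e j) = CartanMatrix.A n i j) ∨
    (4 ≤ n ∧ ∀ i j, b.cartanMatrix (e i) (e j) = CartanMatrix.D n i j)

end Weights

/-- One half of the interlacing condition, for the coordinates with respect to the fundamental
weights (numbered from `0`, so that the last two have numbers `n - 2` and `n - 1`). -/
structure HalfInterlacing {n : ℕ} (a c : Fin n → ℤ) : Prop where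
  last : ∀ i j : Fin n, i.val + 2 = n → j.val + 1 = n → 0 < a i + a j → c i + c j = 0
  between : ∀ i j : Fin n, i < j → ¬ (i.val + 2 = n ∧ j.val + 1 = n) → a i = 1 → a j = 1 →
    ∃ s, i < s ∧ s < j ∧ c s = 1

/-- The pair of integral weights `(λ₁, λ₂)` is interlacing. The requirement `λ₁ + λ₂ ∈ P⁺(1)` reads
`0 ≤ (λ₁ + λ₂)(h_i) ≤ d_i` and `d_i = 1` in the simply laced types. -/
structure IsInterlacing {𝔤 : Type*} [LieRing 𝔤] [LieAlgebra ℂ 𝔤] [FiniteDimensional ℂ 𝔤]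
    [IsKilling ℂ 𝔤] {H : LieSubalgebra ℂ 𝔤} [H.IsCartanSubalgebra] {b : (rootSystem H).Base}
    {n : ℕ} (e : Fin n ≃ b.support) (lam₁ lam₂ : weightLattice H) : Prop where
  sum_nonneg : ∀ i, 0 ≤ value (lam₁ + lam₂) (e i)
  sum_le_one : ∀ i, value (lam₁ + lam₂) (e i) ≤ 1
  left : HalfInterlacing (fun i => value lam₁ (e i)) (fun i => value lam₂ (e i))
  right : HalfInterlacing (fun i => value lam₂ (e i)) (fun i => value lam₁ (e i))

end CurrentAlg

end

/-! The difference `ν₁ - ν₂ = λ₁ - λ₂` takes values of absolute value at most 2 on all coroots. To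
see this, realize the simple roots of type A or D as integral vectors of square length 2 in
Euclidean space, and write the difference as the inner product with a vector `E`. Interlacing makes
the coordinates of `E` alternating partial sums, so they can be chosen in `[-1, 1]`. A root `u` then
pairs with `E` to at most `∑ |u_l| ≤ ∑ u_l² = 2` (`IsInterlacing.hasSymmPairing_and_abs_le`).

Let `ν₁` be the larger weight on `β`. A difference of 1 would make the exponent of `u_β` equal to
the maximum in the lowering relation, so `u_β` would vanish. Hence `ν₁(h_β) = k + 1` and `ν₂(h_β) =
k - 1`, with exponent `k`; `MinimalData` records this situation. If `β = α + γ` with `α`, `γ`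
positive, then the difference is 1 on both summands: otherwise the sum `ν₁ + ν₂` is even on both,
minimality kills both middle vectors, and their commutator kills `u_β` (`MinimalData.value_of_add`).

It remains to check the relations of `V(ν₁ - β, ν₂)` on `u_β` (`MinimalData.satisfiesRelations`).
Raising operators send `u_β` to vectors killed by the relations or by minimality. Integrability
follows from local nilpotency and the representation theory of `sl₂`. The lowering relations need
quadratic relations on the generator; these come from Garland's identity in degree two
(`sum_antidiagonal_smul_eq_zero`) and are moved between roots by commutators. The other half of the
statement follows because the relations are symmetric in the two weights. -/

noncomputable section

/-! ### Operator identities: a Garland-type identity, local nilpotency, `sl₂`. -/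

namespace CurrentAlg

section Abstract

/-- The Euler operator `u d/du` on power series. -/
def eulerOp {A : Type*} [Ring A] (F : PowerSeries A) : PowerSeries A :=
  PowerSeries.mk fun n => (n : A) * PowerSeries.coeff n F

theorem coeff_eulerOp {A : Type*} [Ring A] (F : PowerSeries A) (n : ℕ) :
    PowerSeries.coeff n (eulerOp F) = (n : A) * PowerSeries.coeff n F := by
  simp [eulerOp]

theorem eulerOp_mul {A : Type*} [Ring A] (F G : PowerSeries A) :
    eulerOp (F * G) = eulerOp F * G + F * eulerOp G := by
  ext n
  simp only [coeff_eulerOp, map_add, PowerSeries.coeff_mul, Finset.mul_sum,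
    ← Finset.sum_add_distrib]
  refine Finset.sum_congr rfl fun p hp => ?_
  rw [← Finset.HasAntidiagonal.mem_antidiagonal.mp hp, Nat.cast_add, add_mul, mul_assoc]
  congr 1
  rw [← mul_assoc, ← mul_assoc, (Nat.cast_commute p.2 _).eq]

theorem eulerOp_pow_mul {A : Type*} [Ring A] {F : PowerSeries A} (hF : Commute F (eulerOp F))
    (r : ℕ) : eulerOp (F ^ r) * F = (r : PowerSeries A) * (F ^ r * eulerOp F) := by
  induction r with
  | zero =>
    have : eulerOp (1 : PowerSeries A) = 0 := by
      ext n
      rw [coeff_eulerOp, PowerSeries.coeff_one]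
      split_ifs with h <;> simp [h]
    simp [this]
  | succ r ih =>
    rw [pow_succ, eulerOp_mul, ih, add_mul, Nat.cast_succ, add_mul, one_mul]
    congr 1
    · rw [mul_assoc, mul_assoc (F ^ r), mul_assoc (F ^ r), hF.eq]
    · rw [mul_assoc, mul_assoc, hF.eq]

/-- Moving `E` past each factor leaves a `G`, and moving that `G` to the right costs `2 * eulerOp F`
per factor. The total cost `r (r + 1) F ^ (r - 1) * eulerOp F` is `r + 1` times the Euler derivative
of `F ^ r`, because `F` commutes with its own derivative. -/
theorem raising_mul_pow {A : Type*} [Ring A] {E F G : PowerSeries A}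
    (hEF : E * F = F * E + G) (hGF : G * F = F * G - 2 * eulerOp F)
    (hF : Commute F (eulerOp F)) (r : ℕ) :
    E * F ^ (r + 1) = F ^ (r + 1) * E + ((r : PowerSeries A) + 1) * (F ^ r * G)
      - ((r : PowerSeries A) + 1) * eulerOp (F ^ r) := by
  induction r with
  | zero =>
    have : eulerOp (1 : PowerSeries A) = 0 := by
      ext n
      rw [coeff_eulerOp, PowerSeries.coeff_one]
      split_ifs with h <;> simp [h]
    simp [this, hEF]
  | succ r ih =>
    have h1 : E * F ^ (r + 1 + 1) = (E * F ^ (r + 1)) * F := by rw [pow_succ _ (r + 1), mul_assoc]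
    have h2 : eulerOp (F ^ (r + 1)) = ((r : PowerSeries A) + 1) * (F ^ r * eulerOp F) := by
      rw [pow_succ, eulerOp_mul, eulerOp_pow_mul hF, add_mul, one_mul]
    rw [h1, ih, sub_mul, add_mul, mul_assoc _ E, hEF, mul_assoc _ _ F, mul_assoc _ G, hGF,
      mul_assoc _ _ F, eulerOp_pow_mul hF, h2]
    push_cast
    have h3 : F ^ r * (2 * eulerOp F) = 2 * (F ^ r * eulerOp F) := by
      rw [← mul_assoc, ← mul_assoc, ← Nat.cast_ofNat (R := PowerSeries A), (Nat.cast_commute 2 _).eq]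
    rw [mul_sub, h3, mul_add, ← mul_assoc, ← mul_assoc (F ^ r) F G, ← pow_succ, ← pow_succ]
    noncomm_ring

variable {A M : Type*} [Ring A] [Algebra ℂ A] [AddCommGroup M] [Module A M] [Module ℂ M]
  [IsScalarTower ℂ A M]

theorem natCast_smul_eq_zero {n : ℕ} (hn : n ≠ 0) {v : M} (h : (n : A) • v = 0) : v = 0 := by
  have h2 : (n : ℂ) • v = 0 := by
    rw [← h, ← algebraMap_smul A (n : ℂ) v, map_natCast]
  exact (smul_eq_zero.mp h2).resolve_left (by exact_mod_cast hn)

/-- A commutative version of Garland's identity, in degree two. -/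
theorem sum_antidiagonal_smul_eq_zero {e : A} {f h : ℕ → A} {w : M}
    (hef : ∀ p, e * f p = f p * e + h (p + 1))
    (hhf : ∀ q p, h q * f p = f p * h q - 2 * f (q + p))
    (hff : ∀ p q, f p * f q = f q * f p)
    (hew : e • w = 0) (hhw : ∀ q, h (q + 1) • w = 0) {s : ℕ} (hs : f 0 ^ (s + 2) • w = 0) :
    ∑ p ∈ Finset.HasAntidiagonal.antidiagonal s, (f p.1 * f p.2) • w = 0 := by
  set F : PowerSeries A := PowerSeries.mk f with hFdef
  -- In the application `e` is a raising operator times `t`, so it carries one power of the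
  -- variable. `G` collects only the `h q` with `q ≥ 1`, which kill `w`.
  set E : PowerSeries A := PowerSeries.X * PowerSeries.C e with hEdef
  set G : PowerSeries A := PowerSeries.X * PowerSeries.mk fun n => h (n + 1) with hGdef
  have hF : Commute F (eulerOp F) := by
    ext n
    rw [PowerSeries.coeff_mul, PowerSeries.coeff_mul, ← Finset.Nat.sum_antidiagonal_swap]
    refine Finset.sum_congr rfl fun p _ => ?_
    simp only [coeff_eulerOp, hFdef, PowerSeries.coeff_mk, Prod.fst_swap, Prod.snd_swap]
    rw [← mul_assoc, ← (Nat.cast_commute p.1 _).eq, mul_assoc, mul_assoc, hff]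
  have hEF : E * F = F * E + G := by
    ext n
    cases n with
    | zero => simp [hEdef, hGdef, mul_assoc]
    | succ n =>
      have : F * E = PowerSeries.X * (F * PowerSeries.C e) := by
        rw [hEdef, ← mul_assoc, ← mul_assoc, PowerSeries.commute_X F |>.eq]
      rw [this, map_add, hEdef, hGdef, mul_assoc, PowerSeries.coeff_succ_X_mul,
        PowerSeries.coeff_succ_X_mul, PowerSeries.coeff_succ_X_mul, PowerSeries.coeff_C_mul,
        PowerSeries.coeff_mul_C, PowerSeries.coeff_mk, PowerSeries.coeff_mk, hef]
  have hGF : G * F = F * G - 2 * eulerOp F := by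
    ext n
    cases n with
    | zero =>
      have : PowerSeries.coeff 0 (2 * eulerOp F) = 0 := by
        rw [PowerSeries.coeff_mul]; simp [coeff_eulerOp]
      rw [map_sub, this]
      simp [hGdef, mul_assoc]
    | succ n =>
      have h1 : F * G = PowerSeries.X * (F * PowerSeries.mk fun n => h (n + 1)) := by
        rw [hGdef, ← mul_assoc, ← mul_assoc, PowerSeries.commute_X F |>.eq]
      have h2 : PowerSeries.coeff (n + 1) (2 * eulerOp F) = 2 * ((n + 1 : ℕ) * f (n + 1)) := by
        rw [two_mul, map_add, coeff_eulerOp, hFdef, PowerSeries.coeff_mk, two_mul]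
      have h3 : ∀ p ∈ Finset.HasAntidiagonal.antidiagonal n, h (p.1 + 1) * f p.2 =
          f p.2 * h (p.1 + 1) - 2 * f (n + 1) := fun p hp => by
        rw [hhf, add_right_comm, Finset.HasAntidiagonal.mem_antidiagonal.mp hp]
      rw [map_sub, h1, h2, hGdef, mul_assoc, PowerSeries.coeff_succ_X_mul,
        PowerSeries.coeff_succ_X_mul, PowerSeries.coeff_mul, PowerSeries.coeff_mul]
      simp only [hFdef, PowerSeries.coeff_mk]
      rw [Finset.sum_congr rfl h3, Finset.sum_sub_distrib, Finset.sum_const,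
        Finset.Nat.card_antidiagonal, nsmul_eq_mul,
        ← Finset.Nat.sum_antidiagonal_swap (n := n) (f := fun p => f p.1 * h (p.2 + 1))]
      simp only [Prod.fst_swap, Prod.snd_swap]
      rw [← mul_assoc, ← mul_assoc, (Nat.cast_commute (n + 1) 2).eq]
  -- Applied to `w`, the commutation identity retains only the derivative term, and the factor `(r +
  -- 1) * (n + 1)` is invertible. So one power of `F` can be traded for one degree in the variable;
  -- from `f 0 ^ (s + 2)`, `s` trades lead to the coefficient of degree `s` in `F ^ 2`.
  have key : ∀ r n, PowerSeries.coeff n (F ^ (r + 1)) • w = 0 →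
      PowerSeries.coeff (n + 1) (F ^ r) • w = 0 := by
    intro r n hn
    have h1 := congrArg (fun g => PowerSeries.coeff (n + 1) g • w) (raising_mul_pow hEF hGF hF r)
    have h2 : PowerSeries.coeff (n + 1) (E * F ^ (r + 1)) • w = 0 := by
      rw [hEdef, mul_assoc, PowerSeries.coeff_succ_X_mul, PowerSeries.coeff_C_mul, mul_smul, hn,
        smul_zero]
    have h3 : PowerSeries.coeff (n + 1) (F ^ (r + 1) * E) • w = 0 := by
      rw [hEdef, ← mul_assoc, PowerSeries.commute_X (F ^ (r + 1)) |>.eq, mul_assoc,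
        PowerSeries.coeff_succ_X_mul, PowerSeries.coeff_mul_C, mul_smul, hew, smul_zero]
    have h4 : PowerSeries.coeff (n + 1) (((r : PowerSeries A) + 1) * (F ^ r * G)) • w = 0 := by
      rw [hGdef, ← mul_assoc, ← mul_assoc, PowerSeries.commute_X (_ * F ^ r) |>.eq, mul_assoc,
        PowerSeries.coeff_succ_X_mul, PowerSeries.coeff_mul, Finset.sum_smul]
      refine Finset.sum_eq_zero fun p _ => ?_
      rw [PowerSeries.coeff_mk, mul_smul, hhw, smul_zero]
    have h5 : PowerSeries.coeff (n + 1) (((r : PowerSeries A) + 1) * eulerOp (F ^ r)) • w =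
        (((r + 1) * (n + 1) : ℕ) : A) • (PowerSeries.coeff (n + 1) (F ^ r) • w) := by
      rw [← Nat.cast_succ, ← nsmul_eq_mul, map_nsmul, coeff_eulerOp, nsmul_eq_mul, ← mul_smul,
        Nat.cast_mul, mul_assoc]
    simp only [map_add, map_sub, add_smul, sub_smul, h2, h3, h4, h5, zero_add, zero_sub] at h1
    exact natCast_smul_eq_zero (A := A) (by positivity) (neg_eq_zero.mp h1.symm)
  have main : ∀ j, j ≤ s → PowerSeries.coeff j (F ^ (s + 2 - j)) • w = 0 := by
    intro j
    induction j with
    | zero => intro _; simpa [hFdef] using hs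
    | succ j ih =>
      intro hj
      refine key _ _ ?_
      rw [show s + 2 - (j + 1) + 1 = s + 2 - j by omega]
      exact ih (by omega)
  have := main s le_rfl
  rw [show s + 2 - s = 2 by omega, pow_two, PowerSeries.coeff_mul, Finset.sum_smul] at this
  simpa [hFdef] using this

/-- In a Heisenberg triple of operators, the central one is locally nilpotent if the other two
are. -/
theorem exists_pow_smul_eq_zero_of_commutator {e x y : A} (hxy : e * x = x * e + y)
    (hye : e * y = y * e) (hyx : x * y = y * x)
    (he : ∀ v : M, ∃ n : ℕ, e ^ n • v = 0) (hx : ∀ v : M, ∃ n : ℕ, x ^ n • v = 0) (v : M) :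
    ∃ n : ℕ, y ^ n • v = 0 := by
  have hpow : ∀ m : ℕ, e * x ^ (m + 1) = x ^ (m + 1) * e + (m + 1 : ℕ) * (x ^ m * y) := by
    intro m
    induction m with
    | zero => simpa using hxy
    | succ m ih =>
      rw [pow_succ, ← mul_assoc, ih, add_mul, mul_assoc _ e, hxy, mul_add, mul_assoc _ _ x,
        mul_assoc _ y x, ← hyx, ← mul_assoc _ x y, ← mul_assoc, ← pow_succ, ← pow_succ,
        Nat.cast_succ (m + 1), add_mul _ 1, one_mul]
      abel
  -- On the kernel of `e`, applying `e` to `x ^ (m + 1) • u = 0` gives `x ^ m • y • u = 0`, and `y •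
  -- u` is again in that kernel.
  have h0 : ∀ (m : ℕ) (u : M), e • u = 0 → x ^ m • u = 0 → y ^ m • u = 0 := by
    intro m
    induction m with
    | zero => intro u _ h; simpa using h
    | succ m ih =>
      intro u hu h
      have h1 := congrArg (fun a => a • u) (hpow m)
      simp only [mul_smul, add_smul, h, hu, smul_zero, zero_add] at h1
      rw [pow_succ, mul_smul]
      refine ih _ ?_ (natCast_smul_eq_zero (A := A) (Nat.succ_ne_zero m) h1.symm)
      rw [← mul_smul, hye, mul_smul, hu, smul_zero]
  obtain ⟨a, ha⟩ := he v
  induction a generalizing v with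
  | zero => exact ⟨0, by simpa using ha⟩
  | succ a ih =>
    obtain ⟨n, hn⟩ := ih (e • v) (by rw [← mul_smul, ← pow_succ, ha])
    have hu : e • (y ^ n • v) = 0 := by
      rw [← mul_smul, ((show Commute e y from hye).pow_right n).eq, mul_smul, hn]
    obtain ⟨m, hm⟩ := hx (y ^ n • v)
    exact ⟨m + n, by rw [pow_add, mul_smul]; exact h0 m _ hu hm⟩

-- Here `y j` stands for the `j`-th iterate of `ad f` on `y 0`. Since `f * y 0 = y 0 * f + y 1`, the
-- claim reduces to a lower nilpotency order of the vector or of `ad f`, whence the double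
-- induction.
omit [Algebra ℂ A] [Module ℂ M] [IsScalarTower ℂ A M] in
theorem exists_pow_smul_smul_eq_zero {f : A} (k : ℕ) (y : ℕ → A)
    (hy : ∀ j, f * y j = y j * f + y (j + 1)) (hk : y k = 0) (n : ℕ) (v : M)
    (hv : f ^ n • v = 0) : ∃ N : ℕ, f ^ N • (y 0 • v) = 0 := by
  induction k generalizing y n v with
  | zero => exact ⟨0, by simp [hk]⟩
  | succ k ihk =>
    induction n generalizing v with
    | zero => exact ⟨0, by simp [show v = 0 by simpa using hv]⟩
    | succ n ihn =>
      obtain ⟨N₁, h₁⟩ := ihn (f • v) (by rw [← mul_smul, ← pow_succ, hv])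
      obtain ⟨N₂, h₂⟩ := ihk (fun j => y (j + 1)) (fun j => hy (j + 1)) hk (n + 1) v hv
      refine ⟨N₁ + N₂ + 1, ?_⟩
      have h3 : f ^ (N₁ + N₂ + 1) • (y 0 • v) =
          f ^ N₂ • (f ^ N₁ • (y 0 • (f • v))) + f ^ N₁ • (f ^ N₂ • (y 1 • v)) := by
        simp only [← mul_smul, ← add_smul]
        congr 1
        rw [pow_succ, mul_assoc, hy, mul_add]
        congr 1
        · rw [add_comm, pow_add]; simp only [mul_assoc]
        · rw [pow_add]; simp only [mul_assoc]
      rw [h3, h₁, h₂, smul_zero, smul_zero, add_zero]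

/-- On a highest weight vector, `e * f ^ (m + 1)` acts as `(m + 1) * (N - m) * f ^ m`. The
coefficient is nonzero for `m > N`, so vanishing of some power descends to the power `N + 1`. -/
theorem pow_succ_smul_eq_zero_of_sl2 {e f h : A} (hef : e * f = f * e + h)
    (hhf : h * f = f * h - 2 * f) {w : M} {N : ℕ} (hew : e • w = 0) (hhw : h • w = (N : A) • w)
    {n : ℕ} (hn : f ^ n • w = 0) : f ^ (N + 1) • w = 0 := by
  have hpow : ∀ m : ℕ, e * f ^ (m + 1) =
      f ^ (m + 1) * e + (m + 1 : ℕ) * (f ^ m * h) - (m + 1 : ℕ) * m * f ^ m := by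
    intro m
    induction m with
    | zero => simpa using hef
    | succ m ih =>
      have h1 : e * f ^ (m + 1 + 1) = e * f ^ (m + 1) * f := by rw [pow_succ _ (m + 1), mul_assoc]
      have h2 : f ^ m * (f * h - 2 * f) = f ^ (m + 1) * h - 2 * f ^ (m + 1) := by
        have : f ^ m * (2 * f) = 2 * (f ^ m * f) := by
          rw [← mul_assoc, ← mul_assoc, ← Nat.cast_ofNat (R := A), (Nat.cast_commute 2 _).eq]
        rw [mul_sub, this, ← mul_assoc, ← pow_succ]
      rw [h1, ih, sub_mul, add_mul, mul_assoc _ e, hef, mul_assoc _ _ f, mul_assoc _ h, hhf, h2,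
        mul_assoc _ _ f, ← pow_succ, mul_add, ← mul_assoc, ← pow_succ]
      push_cast
      noncomm_ring
  have hstep : ∀ m, N < m → f ^ (m + 1) • w = 0 → f ^ m • w = 0 := by
    intro m hm h0
    have h1 := congrArg (fun a => a • w) (hpow m)
    simp only [mul_smul, add_smul, sub_smul, h0, hew, hhw, smul_zero, zero_add] at h1
    obtain ⟨d, rfl⟩ := Nat.exists_eq_add_of_lt hm
    refine natCast_smul_eq_zero (A := A) (n := (N + d + 1 + 1) * (d + 1)) (by positivity) ?_
    rw [← mul_smul (f ^ _), ← (Nat.cast_commute N _).eq] at h1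
    simp only [← mul_smul, ← sub_smul] at h1
    rw [← mul_smul, ← neg_eq_zero, ← neg_smul]
    rw [eq_comm] at h1
    convert h1 using 2
    push_cast
    noncomm_ring
  rcases le_total n (N + 1) with h1 | h1
  · rw [← Nat.sub_add_cancel h1, pow_add, mul_smul, hn, smul_zero]
  · obtain ⟨k, rfl⟩ := Nat.exists_eq_add_of_le h1
    induction k with
    | zero => exact hn
    | succ k ih => exact ih (hstep _ (by omega) hn) (by omega)

end Abstract

end CurrentAlg

/-! ### Simply laced root systems, values of weights, brackets of root vectors. -/

namespace CurrentAlg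

section SimplyLaced

variable {ι R M N : Type*} [Finite ι] [CommRing R] [CharZero R] [IsDomain R]
  [AddCommGroup M] [Module R M] [AddCommGroup N] [Module R N] (P : RootPairing ι R M N)
  [P.IsCrystallographic] [P.IsReduced]

/-- A root pairing is simply laced if the pairing between roots and coroots is symmetric. -/
def HasSymmPairing : Prop :=
  ∀ i j, P.pairingIn ℤ i j = P.pairingIn ℤ j i

variable {P}

omit [Finite ι] [IsDomain R] [P.IsReduced] in
theorem pairingIn_of_root_add {i j k : ι} (hk : P.root k = P.root i + P.root j) (l : ι) :
    P.pairingIn ℤ k l = P.pairingIn ℤ i l + P.pairingIn ℤ j l := by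
  apply FaithfulSMul.algebraMap_injective ℤ R
  rw [map_add, P.algebraMap_pairingIn, P.algebraMap_pairingIn, P.algebraMap_pairingIn,
    ← P.root_coroot_eq_pairing, hk, map_add, LinearMap.add_apply, P.root_coroot_eq_pairing,
    P.root_coroot_eq_pairing]

theorem HasSymmPairing.pairingIn_mem (hs : HasSymmPairing P) {i j : ι} (hij : i ≠ j)
    (hij' : P.root i ≠ -P.root j) :
    P.pairingIn ℤ i j = -1 ∨ P.pairingIn ℤ i j = 0 ∨ P.pairingIn ℤ i j = 1 := by
  have : Module.IsReflexive R M := .of_isPerfPair P.toLinearMap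
  have h := P.pairingIn_pairingIn_mem_set_of_isCrystal_of_isRed i j
  have h2 := (P.pairingIn_two_two_iff ℤ i j).not.mpr hij
  have h3 := (P.pairingIn_neg_two_neg_two_iff ℤ i j).not.mpr hij'
  rw [hs j i] at h h2 h3
  simp only [Set.mem_insert_iff, Set.mem_singleton_iff, Prod.mk.injEq] at h
  omega

theorem HasSymmPairing.pairingIn_eq_neg_one (hs : HasSymmPairing P) {i j k : ι}
    (hk : P.root k = P.root i + P.root j) : P.pairingIn ℤ i j = -1 := by
  have : Module.IsReflexive R M := .of_isPerfPair P.toLinearMap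
  have h1 := pairingIn_of_root_add hk j
  rw [P.pairingIn_same] at h1
  have h2 := P.pairingIn_pairingIn_mem_set_of_isCrystal_of_isRed k j
  have hkj : k ≠ j := by
    rintro rfl
    exact P.ne_zero i (by simpa using hk)
  have h3 := (P.pairingIn_two_two_iff ℤ k j).not.mpr hkj
  rw [hs j k] at h2 h3
  have hij : P.root i ≠ -P.root j := fun h => P.ne_zero k (by rw [hk, h, neg_add_cancel])
  by_cases h : i = j
  · subst h
    rw [P.pairingIn_same] at h1
    rw [h1] at h2
    simp at h2
  · have := hs.pairingIn_mem h hij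
    simp only [Set.mem_insert_iff, Set.mem_singleton_iff, Prod.mk.injEq] at h2
    omega

/-- The root `k` is the reflection of `i` in `j`, and the symmetric pairing makes the same
coefficient appear on the coroot side. This is what makes the value of a weight additive in the
root. -/
theorem HasSymmPairing.coroot_add (hs : HasSymmPairing P) {i j k : ι}
    (hk : P.root k = P.root i + P.root j) : P.coroot k = P.coroot i + P.coroot j := by
  have h1 : P.pairing i j = -1 := by
    rw [← P.algebraMap_pairingIn ℤ, hs.pairingIn_eq_neg_one hk]; simp
  have h2 : P.pairing j i = -1 := by
    rw [← P.algebraMap_pairingIn ℤ, hs j i, hs.pairingIn_eq_neg_one hk]; simp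
  have h3 : k = P.reflectionPerm j i := by
    apply P.root.injective
    rw [P.root_reflectionPerm, P.reflection_apply_root, h1, hk]
    simp
  rw [h3, P.coroot_reflectionPerm, P.coreflection_apply_coroot, h2]
  simp

end SimplyLaced

open LieAlgebra LieAlgebra.IsKilling

variable {𝔤 : Type*} [LieRing 𝔤] [LieAlgebra ℂ 𝔤] [FiniteDimensional ℂ 𝔤] [IsKilling ℂ 𝔤]
  {H : LieSubalgebra ℂ 𝔤} [H.IsCartanSubalgebra]

section Values

theorem value_add (a c : weightLattice H) (α : H.root) :
    value (a + c) α = value a α + value c α := by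
  have h := value_spec (a + c) α
  rw [AddSubgroup.coe_add, LinearMap.add_apply, value_spec, value_spec] at h
  exact_mod_cast h.symm

theorem value_sub (a c : weightLattice H) (α : H.root) :
    value (a - c) α = value a α - value c α := by
  have h := value_spec (a - c) α
  rw [AddSubgroup.coe_sub, LinearMap.sub_apply, value_spec, value_spec] at h
  exact_mod_cast h.symm

theorem value_rootWeight (β α : H.root) :
    value (rootWeight β) α = (rootSystem H).pairingIn ℤ β α := by
  have h := value_spec (rootWeight β) α
  have h2 := (rootSystem H).algebraMap_pairingIn ℤ β α
  rw [rootSystem_pairing_apply] at h2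
  have h3 : ((rootWeight β : weightLattice H) : Module.Dual ℂ H) (coroot α.1) =
      β.1 (coroot α.1) := rfl
  rw [h3, ← h2, eq_intCast] at h
  exact_mod_cast h.symm

theorem value_of_root_add (hs : HasSymmPairing (rootSystem H)) (lam : weightLattice H)
    {α β γ : H.root}
    (hγ : (rootSystem H).root γ = (rootSystem H).root α + (rootSystem H).root β) :
    value lam γ = value lam α + value lam β := by
  have h := value_spec lam γ
  have h2 := hs.coroot_add hγ
  simp only [rootSystem_coroot_apply] at h2
  rw [h2, map_add, value_spec, value_spec] at h
  exact_mod_cast h.symm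

theorem IsDominant.value_nonneg (hs : HasSymmPairing (rootSystem H)) {b : (rootSystem H).Base}
    {lam : weightLattice H} (hlam : IsDominant b lam) {α : H.root} (hα : b.IsPos α) :
    0 ≤ value lam α := by
  refine hα.induction_on_add (p := fun α => 0 ≤ value lam α) hlam fun i j k hk hi hj => ?_
  rw [value_of_root_add hs lam hk]
  exact add_nonneg hi (hlam j hj)

end Values

section RootSpaces

theorem root_eq_iff {α β γ : H.root} :
    (rootSystem H).root γ = (rootSystem H).root α + (rootSystem H).root β ↔
      (γ.1 : H → ℂ) = (α.1 : H → ℂ) + (β.1 : H → ℂ) := by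
  constructor
  · intro h
    ext x
    exact LinearMap.congr_fun h x
  · intro h
    ext x
    exact congrFun h x

theorem exists_eq_smul_of_mem_rootSpace {α : LieModule.Weight ℂ H 𝔤} (hα : α.IsNonZero) {x y : 𝔤}
    (hx : x ∈ rootSpace H (α : H → ℂ)) (hy : y ∈ rootSpace H (α : H → ℂ)) (hx0 : x ≠ 0) :
    ∃ c : ℂ, y = c • x := by
  obtain ⟨c, hc⟩ := (finrank_eq_one_iff_of_nonzero' (⟨x, hx⟩ : rootSpace H (α : H → ℂ))
    (by simpa [Subtype.ext_iff] using hx0)).mp (finrank_rootSpace_eq_one α hα) ⟨y, hy⟩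
  exact ⟨c, (congrArg Subtype.val hc).symm⟩

theorem exists_eq_smul_of_mem_rootSpace_neg (α : H.root) {x y : 𝔤}
    (hx : x ∈ rootSpace H (-(α.1 : H → ℂ))) (hy : y ∈ rootSpace H (-(α.1 : H → ℂ)))
    (hx0 : x ≠ 0) : ∃ c : ℂ, y = c • x :=
  exists_eq_smul_of_mem_rootSpace (α := -α.1) (H.isNonZero_coe_root α).neg
    (by simpa using hx) (by simpa using hy) hx0

theorem exists_lie_eq_coroot (α : H.root) {x : 𝔤} (hx : x ∈ rootSpace H (-(α.1 : H → ℂ)))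
    (hx0 : x ≠ 0) : ∃ e ∈ rootSpace H (α.1 : H → ℂ), ⁅e, x⁆ = (coroot α.1 : H) := by
  obtain ⟨h, e, f, ht, he, hf⟩ := exists_isSl2Triple_of_weight_isNonZero (H.isNonZero_coe_root α)
  obtain ⟨c, rfl⟩ := exists_eq_smul_of_mem_rootSpace_neg α hx hf hx0
  refine ⟨c • e, Submodule.smul_mem _ c he, ?_⟩
  rw [smul_lie, ← lie_smul, ht.lie_e_f, ht.h_eq_coroot (H.isNonZero_coe_root α) he hf]

theorem lie_coe_eq_neg_smul (α : H.root) {x : 𝔤} (hx : x ∈ rootSpace H (-(α.1 : H → ℂ))) (h : H) :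
    ⁅(h : 𝔤), x⁆ = -(α.1 h) • x :=
  lie_eq_smul_of_mem_rootSpace hx h

theorem lie_mem_rootSpace_neg {α β γ : H.root}
    (hγ : (rootSystem H).root γ = (rootSystem H).root α + (rootSystem H).root β) {x y : 𝔤}
    (hx : x ∈ rootSpace H (-(α.1 : H → ℂ))) (hy : y ∈ rootSpace H (-(β.1 : H → ℂ))) :
    ⁅x, y⁆ ∈ rootSpace H (-(γ.1 : H → ℂ)) := by
  rw [root_eq_iff.mp hγ, neg_add]
  exact lie_mem_genWeightSpace_of_mem_genWeightSpace hx hy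

/-- If the bracket vanished, `x` would be a primitive vector for the `sl₂`-triple of `β` with its
two root vectors exchanged. Its weight would be `-1`, which is impossible in finite dimension. -/
theorem lie_ne_zero_of_root_add (hs : HasSymmPairing (rootSystem H)) {α β γ : H.root}
    (hγ : (rootSystem H).root γ = (rootSystem H).root α + (rootSystem H).root β) {x y : 𝔤}
    (hx : x ∈ rootSpace H (-(α.1 : H → ℂ))) (hy : y ∈ rootSpace H (-(β.1 : H → ℂ)))
    (hx0 : x ≠ 0) (hy0 : y ≠ 0) : ⁅x, y⁆ ≠ 0 := by
  intro h0
  obtain ⟨h, e, f, ht, he, hf⟩ := exists_isSl2Triple_of_weight_isNonZero (H.isNonZero_coe_root β)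
  obtain ⟨c, hc⟩ := exists_eq_smul_of_mem_rootSpace_neg β hy hf hy0
  have hp : (rootSystem H).pairing α β = -1 := by
    rw [← (rootSystem H).algebraMap_pairingIn ℤ, hs.pairingIn_eq_neg_one hγ]; simp
  rw [rootSystem_pairing_apply] at hp
  have P : ht.symm.HasPrimitiveVectorWith x (-1 : ℂ) :=
    { ne_zero := hx0
      lie_h := by
        rw [neg_lie, ht.h_eq_coroot (H.isNonZero_coe_root β) he hf]
        have := lie_eq_smul_of_mem_rootSpace hx (coroot β.1)
        rw [LieSubalgebra.coe_bracket_of_module] at this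
        rw [this, Pi.neg_apply, hp, neg_neg, one_smul, neg_one_smul]
      lie_e := by rw [hc, smul_lie, ← lie_skew, h0, neg_zero, smul_zero] }
  obtain ⟨n, hn⟩ := P.exists_nat
  have : ((n + 1 : ℕ) : ℂ) = 0 := by rw [Nat.cast_add, ← hn]; simp
  exact Nat.succ_ne_zero n (by exact_mod_cast this)

omit [IsKilling ℂ 𝔤] in
theorem eq_zero_or_exists_root {χ : H → ℂ} (hχ : χ ≠ 0) {x : 𝔤} (hx : x ∈ rootSpace H χ) :
    x = 0 ∨ ∃ γ : H.root, (γ.1 : H → ℂ) = χ := by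
  by_cases h : rootSpace H χ = ⊥
  · left
    rw [h] at hx
    simpa using hx
  · right
    refine ⟨⟨⟨χ, h⟩, ?_⟩, rfl⟩
    simpa [LieModule.Weight.IsNonZero, LieModule.Weight.IsZero] using hχ

theorem lie_eq_zero_of_forall_root_ne {α β : H.root}
    (h : ∀ γ, (rootSystem H).root γ ≠ (rootSystem H).root α + (rootSystem H).root β)
    (h' : (rootSystem H).root α ≠ -(rootSystem H).root β) {x y : 𝔤}
    (hx : x ∈ rootSpace H (-(α.1 : H → ℂ))) (hy : y ∈ rootSpace H (-(β.1 : H → ℂ))) :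
    ⁅x, y⁆ = 0 := by
  have hm := lie_mem_genWeightSpace_of_mem_genWeightSpace hx hy
  have hχ : -(α.1 : H → ℂ) + -(β.1 : H → ℂ) ≠ 0 := by
    intro h0
    apply h'
    ext z
    have := congrFun h0 z
    simp only [Pi.add_apply, Pi.neg_apply, Pi.zero_apply] at this
    change α.1 z = - β.1 z
    linear_combination -this
  refine (eq_zero_or_exists_root hχ hm).resolve_right ?_
  rintro ⟨γ, hγ⟩
  refine h ((rootSystem H).reflectionPerm γ γ) ?_
  rw [(rootSystem H).root_reflectionPerm, (rootSystem H).reflection_apply_self]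
  ext z
  change -γ.1 z = α.1 z + β.1 z
  rw [congrFun hγ z]
  simp only [Pi.add_apply, Pi.neg_apply]
  ring

theorem lie_eq_zero_of_pairingIn_nonneg (hs : HasSymmPairing (rootSystem H)) {α β : H.root}
    (h : 0 ≤ (rootSystem H).pairingIn ℤ α β) {x y : 𝔤}
    (hx : x ∈ rootSpace H (-(α.1 : H → ℂ))) (hy : y ∈ rootSpace H (-(β.1 : H → ℂ))) :
    ⁅x, y⁆ = 0 := by
  refine lie_eq_zero_of_forall_root_ne (fun γ hγ => ?_) (fun h' => ?_) hx hy
  · rw [hs.pairingIn_eq_neg_one hγ] at h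
    omega
  · rw [((rootSystem H).pairingIn_neg_two_neg_two_iff ℤ α β).mpr h' |>.1] at h
    omega

theorem exists_ne_zero_mem_rootSpace_neg (α : H.root) :
    ∃ x ∈ rootSpace H (-(α.1 : H → ℂ)), x ≠ 0 := by
  obtain ⟨x, hx, hx0⟩ := (-α.1).exists_ne_zero
  exact ⟨x, by simpa using hx, hx0⟩

end RootSpaces

end CurrentAlg

/-! ### Vectors in current algebra modules satisfying the defining relations. -/

namespace CurrentAlg

section CurrentElements

variable {𝔤 : Type*} [LieRing 𝔤] [LieAlgebra ℂ 𝔤]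

theorem cur_mul_cur (x y : 𝔤) (r s : ℕ) :
    cur x r * cur y s = cur y s * cur x r + cur ⁅x, y⁆ (r + s) := by
  let _ : LieRing (UCurrent 𝔤) := LieRing.ofAssociativeRing
  have h := (UniversalEnvelopingAlgebra.ι ℂ).map_lie
    (((Polynomial.X : ℂ[X]) ^ r) ⊗ₜ[ℂ] x) (((Polynomial.X : ℂ[X]) ^ s) ⊗ₜ[ℂ] y)
  rw [LieAlgebra.ExtendScalars.bracket_tmul, ← pow_add, LieRing.of_associative_ring_bracket] at h
  simp only [cur]
  rw [h]
  abel

theorem mkAlgHom_surjective :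
    Function.Surjective (UniversalEnvelopingAlgebra.mkAlgHom ℂ (Current 𝔤)) := by
  intro u
  exact RingCon.mkₐ_surjective (α := ℂ) _ u

theorem ucurrent_induction {p : UCurrent 𝔤 → Prop}
    (halg : ∀ c : ℂ, p (algebraMap ℂ _ c)) (hcur : ∀ (x : 𝔤) (r : ℕ), p (cur x r))
    (hadd : ∀ u v, p u → p v → p (u + v)) (hmul : ∀ u v, p u → p v → p (u * v))
    (u : UCurrent 𝔤) : p u := by
  have h0 : p 0 := by simpa using halg 0
  have hι : ∀ z : Current 𝔤, p (UniversalEnvelopingAlgebra.ι ℂ z) := by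
    intro z
    induction z using TensorProduct.induction_on with
    | zero => simpa using h0
    | add a c ha hc => rw [map_add]; exact hadd _ _ ha hc
    | tmul f x =>
      induction f using Polynomial.induction_on' with
      | add f g hf hg => rw [TensorProduct.add_tmul, map_add]; exact hadd _ _ hf hg
      | monomial n a =>
        rw [← Polynomial.C_mul_X_pow_eq_monomial, ← Polynomial.smul_eq_C_mul,
          ← TensorProduct.smul_tmul', map_smul, Algebra.smul_def]
        exact hmul _ _ (halg a) (hcur x n)
  obtain ⟨t, rfl⟩ := mkAlgHom_surjective u
  induction t using TensorAlgebra.induction with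
  | algebraMap c => rw [AlgHom.commutes]; exact halg c
  | ι z => exact hι z
  | mul a c ha hc => rw [map_mul]; exact hmul _ _ ha hc
  | add a c ha hc => rw [map_add]; exact hadd _ _ ha hc

theorem cur_smul (c : ℂ) (x : 𝔤) (r : ℕ) : cur (c • x) r = c • cur x r := by
  simp [cur]

theorem cur_zero (r : ℕ) : cur (0 : 𝔤) r = 0 := by
  simp [cur]

end CurrentElements

open LieAlgebra LieAlgebra.IsKilling

variable {𝔤 : Type*} [LieRing 𝔤] [LieAlgebra ℂ 𝔤] [FiniteDimensional ℂ 𝔤] [IsKilling ℂ 𝔤]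
  {H : LieSubalgebra ℂ 𝔤} [H.IsCartanSubalgebra]

omit [FiniteDimensional ℂ 𝔤] [IsKilling ℂ 𝔤] in
theorem cur_mul_cur_of_lie_eq_zero {x y : 𝔤} (h : ⁅x, y⁆ = 0) (r s : ℕ) :
    cur x r * cur y s = cur y s * cur x r := by
  rw [cur_mul_cur, h, cur_zero, add_zero]

theorem cur_cartan_mul (α : H.root) {x : 𝔤} (hx : x ∈ rootSpace H (-(α.1 : H → ℂ))) (h : H)
    (q p : ℕ) :
    cur (h : 𝔤) q * cur x p = cur x p * cur (h : 𝔤) q - α.1 h • cur x (q + p) := by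
  rw [cur_mul_cur, lie_coe_eq_neg_smul α hx, cur_smul, neg_smul, ← sub_eq_add_neg]

theorem cur_coroot_mul (α : H.root) {x : 𝔤} (hx : x ∈ rootSpace H (-(α.1 : H → ℂ))) (q p : ℕ) :
    cur ((coroot α.1 : H) : 𝔤) q * cur x p =
      cur x p * cur ((coroot α.1 : H) : 𝔤) q - 2 * cur x (q + p) := by
  rw [cur_cartan_mul α hx, root_apply_coroot (H.isNonZero_coe_root α), Algebra.smul_def, map_ofNat]

variable {M : Type*} [AddCommGroup M] [Module (UCurrent 𝔤) M]
  {b : (rootSystem H).Base} {lam mu : weightLattice H} {w : M}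

/-- The vector `w` satisfies the defining relations of `V(λ, μ)`. -/
def SatisfiesRelations (b : (rootSystem H).Base) (lam mu : weightLattice H) (w : M) : Prop :=
  ∀ u : UCurrent 𝔤, IsRelator b lam mu u → u • w = 0

namespace SatisfiesRelations

theorem cartan_smul (hw : SatisfiesRelations b lam mu w) (h : H) {r : ℕ} (hr : r ≠ 0) :
    cur (h : 𝔤) r • w = 0 := by
  simpa [hr] using hw _ (.cartan h r)

theorem cartan_zero_smul (hw : SatisfiesRelations b lam mu w) (h : H) :
    cur (h : 𝔤) 0 • w =
      algebraMap ℂ (UCurrent 𝔤) (((lam + mu : weightLattice H) : Module.Dual ℂ H) h) • w := by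
  have := hw _ (.cartan h 0)
  rwa [if_pos rfl, sub_smul, sub_eq_zero] at this

theorem coroot_smul (hw : SatisfiesRelations b lam mu w) (α : H.root) {N : ℕ}
    (hN : value (lam + mu) α = N) :
    cur ((coroot α.1 : H) : 𝔤) 0 • w = (N : UCurrent 𝔤) • w := by
  rw [hw.cartan_zero_smul, value_spec, hN, Int.cast_natCast, map_natCast]

theorem raising_smul (hw : SatisfiesRelations b lam mu w) {α : H.root} (hα : b.IsPos α) {x : 𝔤}
    (hx : x ∈ rootSpace H (α.1 : H → ℂ)) (r : ℕ) : cur x r • w = 0 :=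
  hw _ (.raising α hα x hx r)

variable [Module ℂ M] [IsScalarTower ℂ (UCurrent 𝔤) M]

/-- The bracket of `h_α ⊗ t` with `x ⊗ t ^ k` is `-2 x ⊗ t ^ (k + 1)`, and `h_α ⊗ t` kills `w`. -/
theorem lowering_smul_of_le (hw : SatisfiesRelations b lam mu w) {α : H.root} {x : 𝔤}
    (hx : x ∈ rootSpace H (-(α.1 : H → ℂ))) {j k : ℕ} (hj : cur x j • w = 0) (hjk : j ≤ k) :
    cur x k • w = 0 := by
  induction k, hjk using Nat.le_induction with
  | base => exact hj
  | succ k _ ih =>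
    have h := congrArg (fun u => u • w) (cur_coroot_mul α hx 1 k)
    simp only [mul_smul, sub_smul, ih, hw.cartan_smul _ one_ne_zero, smul_zero, zero_sub] at h
    rw [add_comm]
    exact natCast_smul_eq_zero (A := UCurrent 𝔤) two_ne_zero (neg_eq_zero.mp h.symm)

theorem lowering_smul (hw : SatisfiesRelations b lam mu w) {α : H.root} (hα : b.IsPos α) {x : 𝔤}
    (hx : x ∈ rootSpace H (-(α.1 : H → ℂ))) {k : ℕ} (h₁ : value lam α ≤ k) (h₂ : value mu α ≤ k) :
    cur x k • w = 0 :=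
  hw.lowering_smul_of_le hx (hw _ (.lowering α hα x hx)) (by omega)

omit [Module ℂ M] [IsScalarTower ℂ (UCurrent 𝔤) M] in
theorem exists_pow_smul_of_mem_support (hw : SatisfiesRelations b lam mu w)
    (hcyc : ∀ v : M, ∃ u : UCurrent 𝔤, v = u • w) {i : H.root} (hi : i ∈ b.support) {x : 𝔤}
    (hx : x ∈ rootSpace H (-(i.1 : H → ℂ))) (v : M) : ∃ n : ℕ, cur x 0 ^ n • v = 0 := by
  have hχ : -(i.1 : H → ℂ) ≠ 0 := neg_ne_zero.mpr (H.isNonZero_coe_root i)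
  obtain ⟨k, hk⟩ := isNilpotent_ad_of_mem_rootSpace H hχ hx
  obtain ⟨u, rfl⟩ := hcyc v
  -- The vectors killed by a power of the operator are stable under the whole algebra, because `ad
  -- x` is nilpotent. The generator is one of them.
  suffices ∀ v : M, (∃ n : ℕ, cur x 0 ^ n • v = 0) → ∃ n : ℕ, cur x 0 ^ n • (u • v) = 0 from
    this w ⟨_, hw _ (.integrable i hi x hx)⟩
  induction u using ucurrent_induction with
  | halg c =>
    rintro v ⟨n, hn⟩
    exact ⟨n, by rw [← mul_smul, ← Algebra.commutes, mul_smul, hn, smul_zero]⟩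
  | hcur y r =>
    rintro v ⟨n, hn⟩
    refine exists_pow_smul_smul_eq_zero k (fun j => cur ((ad ℂ 𝔤 x ^ j) y) r) (fun j => ?_) ?_ n v hn
    · rw [cur_mul_cur, zero_add, pow_succ', Module.End.mul_apply, ad_apply]
    · simp only [hk, LinearMap.zero_apply, cur_zero]
  | hadd u₁ u₂ h₁ h₂ =>
    intro v hv
    obtain ⟨n, hn⟩ := h₁ v hv
    obtain ⟨m, hm⟩ := h₂ v hv
    refine ⟨n + m, ?_⟩
    have hm' : cur x 0 ^ (n + m) • u₂ • v = 0 := by rw [pow_add, mul_smul, hm, smul_zero]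
    rw [add_smul, smul_add, hm', add_comm n, pow_add, mul_smul, hn, smul_zero, add_zero]
  | hmul u₁ u₂ h₁ h₂ =>
    intro v hv
    rw [mul_smul]
    exact h₁ _ (h₂ v hv)

/-- Induction on adding simple roots: two root vectors and their bracket form a Heisenberg triple,
since in a simply laced system the bracket commutes with both. -/
theorem exists_pow_smul (hs : HasSymmPairing (rootSystem H)) (hw : SatisfiesRelations b lam mu w)
    (hcyc : ∀ v : M, ∃ u : UCurrent 𝔤, v = u • w) {α : H.root} (hα : b.IsPos α) {x : 𝔤}
    (hx : x ∈ rootSpace H (-(α.1 : H → ℂ))) (v : M) : ∃ n : ℕ, cur x 0 ^ n • v = 0 := by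
  refine hα.induction_on_add (p := fun α => ∀ x ∈ rootSpace H (-(α.1 : H → ℂ)), ∀ v : M,
    ∃ n : ℕ, cur x 0 ^ n • v = 0)
    (fun i hi x hx v => hw.exists_pow_smul_of_mem_support hcyc hi hx v) ?_ x hx v
  intro i j k hk hi hj x hx
  obtain ⟨y, hy, hy0⟩ := exists_ne_zero_mem_rootSpace_neg i
  obtain ⟨z, hz, hz0⟩ := exists_ne_zero_mem_rootSpace_neg j
  have hne := lie_ne_zero_of_root_add hs hk hy hz hy0 hz0
  have hyz := lie_mem_rootSpace_neg hk hy hz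
  obtain ⟨c, rfl⟩ := exists_eq_smul_of_mem_rootSpace_neg k hyz hx hne
  have hij := hs.pairingIn_eq_neg_one hk
  have hki : ⁅y, ⁅y, z⁆⁆ = 0 := by
    refine lie_eq_zero_of_pairingIn_nonneg hs ?_ hy hyz
    rw [hs, pairingIn_of_root_add hk, (rootSystem H).pairingIn_same, hs, hij]
    norm_num
  have hkj : ⁅z, ⁅y, z⁆⁆ = 0 := by
    refine lie_eq_zero_of_pairingIn_nonneg hs ?_ hz hyz
    rw [hs, pairingIn_of_root_add hk, (rootSystem H).pairingIn_same, hij]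
    norm_num
  have hnil := exists_pow_smul_eq_zero_of_commutator (M := M) (e := cur y 0) (x := cur z 0)
    (y := cur ⁅y, z⁆ 0) (cur_mul_cur y z 0 0) (cur_mul_cur_of_lie_eq_zero hki 0 0)
    (cur_mul_cur_of_lie_eq_zero hkj 0 0) (hi y hy)
    (fun v => hw.exists_pow_smul_of_mem_support hcyc hj hz v)
  intro v
  obtain ⟨n, hn⟩ := hnil v
  exact ⟨n, by rw [cur_smul, smul_pow, smul_assoc, hn, smul_zero]⟩

theorem pow_succ_smul (hs : HasSymmPairing (rootSystem H)) (hw : SatisfiesRelations b lam mu w)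
    (hcyc : ∀ v : M, ∃ u : UCurrent 𝔤, v = u • w) {α : H.root} (hα : b.IsPos α) {x : 𝔤}
    (hx : x ∈ rootSpace H (-(α.1 : H → ℂ))) {N : ℕ} (hN : value (lam + mu) α = N) :
    cur x 0 ^ (N + 1) • w = 0 := by
  rcases eq_or_ne x 0 with rfl | hx0
  · rw [cur_zero, zero_pow N.succ_ne_zero, zero_smul]
  obtain ⟨e, he, hex⟩ := exists_lie_eq_coroot α hx hx0
  obtain ⟨n, hn⟩ := hw.exists_pow_smul hs hcyc hα hx w
  exact pow_succ_smul_eq_zero_of_sl2 (by rw [cur_mul_cur, hex]) (cur_coroot_mul α hx 0 0)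
    (hw.raising_smul hα he 0) (hw.coroot_smul α hN) hn

theorem sum_antidiagonal_smul (hs : HasSymmPairing (rootSystem H))
    (hw : SatisfiesRelations b lam mu w) (hcyc : ∀ v : M, ∃ u : UCurrent 𝔤, v = u • w)
    {α : H.root} (hα : b.IsPos α) {x : 𝔤} (hx : x ∈ rootSpace H (-(α.1 : H → ℂ))) {N s : ℕ}
    (hN : value (lam + mu) α = N) (hNs : N ≤ s + 1) :
    ∑ p ∈ Finset.HasAntidiagonal.antidiagonal s, (cur x p.1 * cur x p.2) • w = 0 := by
  rcases eq_or_ne x 0 with rfl | hx0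
  · simp [cur_zero]
  obtain ⟨e, he, hex⟩ := exists_lie_eq_coroot α hx hx0
  refine sum_antidiagonal_smul_eq_zero (e := cur e 1) (h := cur ((coroot α.1 : H) : 𝔤))
    (fun p => by rw [cur_mul_cur, hex, add_comm 1]) (cur_coroot_mul α hx)
    (cur_mul_cur_of_lie_eq_zero (lie_self x)) (hw.raising_smul hα he 1)
    (fun q => hw.cartan_smul _ q.succ_ne_zero) ?_
  obtain ⟨d, hd⟩ := Nat.exists_eq_add_of_le hNs
  rw [show s + 2 = d + (N + 1) by omega, pow_add, mul_smul,
    hw.pow_succ_smul hs hcyc hα hx hN, smul_zero]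

/-- In Garland's sum of total degree `2 * a`, every product other than the middle one has a factor
of degree at least `a + 1`. The factors commute, so that factor can act on `w` first. -/
theorem cur_mul_self_smul (hs : HasSymmPairing (rootSystem H))
    (hw : SatisfiesRelations b lam mu w) (hcyc : ∀ v : M, ∃ u : UCurrent 𝔤, v = u • w)
    {α : H.root} (hα : b.IsPos α) {x : 𝔤} (hx : x ∈ rootSpace H (-(α.1 : H → ℂ))) {a : ℕ}
    (hpos : 0 ≤ value (lam + mu) α) (ha : value (lam + mu) α ≤ 2 * a + 1)
    (hxa : cur x (a + 1) • w = 0) : cur x a • cur x a • w = 0 := by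
  obtain ⟨N, hN⟩ := Int.eq_ofNat_of_zero_le hpos
  have h := hw.sum_antidiagonal_smul hs hcyc hα hx (s := 2 * a) hN (by omega)
  rwa [Finset.sum_eq_single (a, a), mul_smul] at h
  · rintro ⟨i, j⟩ hij hne
    have hij' : i + j = 2 * a := by simpa using hij
    rcases lt_or_ge a j with hj | hj
    · rw [mul_smul, hw.lowering_smul_of_le hx hxa hj, smul_zero]
    · have : i ≠ a := by
        rintro rfl
        exact hne (by rw [show j = i by omega])
      rw [cur_mul_cur_of_lie_eq_zero (lie_self x), mul_smul,
        hw.lowering_smul_of_le hx hxa (by omega), smul_zero]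
  · intro h
    exact absurd (by simp; omega) h

/-- The odd total degree `2 * a + 1` leaves two middle products. They coincide, so twice their
common value vanishes. -/
theorem cur_mul_succ_smul (hs : HasSymmPairing (rootSystem H))
    (hw : SatisfiesRelations b lam mu w) (hcyc : ∀ v : M, ∃ u : UCurrent 𝔤, v = u • w)
    {α : H.root} (hα : b.IsPos α) {x : 𝔤} (hx : x ∈ rootSpace H (-(α.1 : H → ℂ))) {a : ℕ}
    (hpos : 0 ≤ value (lam + mu) α) (ha : value (lam + mu) α ≤ 2 * a + 2)
    (hxa : cur x (a + 2) • w = 0) : cur x a • cur x (a + 1) • w = 0 := by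
  obtain ⟨N, hN⟩ := Int.eq_ofNat_of_zero_le hpos
  have h := hw.sum_antidiagonal_smul hs hcyc hα hx (s := 2 * a + 1) hN (by omega)
  rw [Finset.sum_eq_add (a, a + 1) (a + 1, a)] at h
  · rw [cur_mul_cur_of_lie_eq_zero (lie_self x) (a + 1), mul_smul, ← two_smul (UCurrent 𝔤)] at h
    exact natCast_smul_eq_zero (A := UCurrent 𝔤) two_ne_zero h
  · simp
  · rintro ⟨i, j⟩ hij hne
    have hij' : i + j = 2 * a + 1 := by simpa using hij
    rcases lt_or_ge (a + 1) j with hj | hj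
    · rw [mul_smul, hw.lowering_smul_of_le hx hxa hj, smul_zero]
    · have h1 : i ≠ a := by
        rintro rfl
        exact hne.1 (by rw [show j = i + 1 by omega])
      have h2 : i ≠ a + 1 := by
        rintro rfl
        exact hne.2 (by rw [show j = a by omega])
      rw [cur_mul_cur_of_lie_eq_zero (lie_self x), mul_smul,
        hw.lowering_smul_of_le hx hxa (by omega), smul_zero]
  · intro h
    exact absurd (by simp; omega) h
  · intro h
    exact absurd (by simp; omega) h

end SatisfiesRelations

end CurrentAlg

/-! ### The relations satisfied by the vector of minimal height. -/

namespace CurrentAlg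

open LieAlgebra LieAlgebra.IsKilling

theorem ceil_half_le {v : ℤ} {k : ℕ} (h : v ≤ 2 * k) : ⌈(v : ℚ) / 2⌉₊ ≤ k := by
  rw [Nat.ceil_le, div_le_iff₀ two_pos]
  have : (v : ℚ) ≤ ((2 * k : ℤ) : ℚ) := by exact_mod_cast h
  push_cast at this
  linarith

theorem le_two_mul_ceil_half (v : ℤ) : v ≤ 2 * (⌈(v : ℚ) / 2⌉₊ : ℕ) := by
  have h := Nat.le_ceil ((v : ℚ) / 2)
  rw [div_le_iff₀ two_pos] at h
  have : (v : ℚ) ≤ ((2 * (⌈(v : ℚ) / 2⌉₊ : ℕ) : ℤ) : ℚ) := by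
    push_cast
    linarith
  exact_mod_cast this

variable {𝔤 : Type*} [LieRing 𝔤] [LieAlgebra ℂ 𝔤]

section Swap

variable {M : Type*} [AddCommGroup M] [Module (UCurrent 𝔤) M]

theorem cur_smul_cur_smul (x y : 𝔤) (r s : ℕ) (v : M) :
    cur x r • cur y s • v = cur y s • cur x r • v + cur ⁅x, y⁆ (r + s) • v := by
  rw [← mul_smul, cur_mul_cur, add_smul, mul_smul]

theorem cur_smul_cur_smul_of_lie_eq_zero {x y : 𝔤} (h : ⁅x, y⁆ = 0) (r s : ℕ) (v : M) :
    cur x r • cur y s • v = cur y s • cur x r • v := by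
  rw [cur_smul_cur_smul, h, cur_zero, zero_smul, add_zero]

theorem cur_lie_smul_eq_zero {x y : 𝔤} {r s : ℕ} {v : M} (hx : cur x r • v = 0)
    (hy : cur y s • v = 0) : cur ⁅x, y⁆ (r + s) • v = 0 := by
  have := cur_smul_cur_smul x y r s v
  rwa [hx, hy, smul_zero, smul_zero, zero_add, eq_comm] at this

end Swap

variable [FiniteDimensional ℂ 𝔤] [IsKilling ℂ 𝔤] {H : LieSubalgebra ℂ 𝔤} [H.IsCartanSubalgebra]
  {M : Type*} [AddCommGroup M] [Module (UCurrent 𝔤) M] [Module ℂ M]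
  [IsScalarTower ℂ (UCurrent 𝔤) M] {b : (rootSystem H).Base} {lam mu : weightLattice H} {w : M}

/-- A cyclic vector `w` with the relations of `V(λ, μ)`, and a positive root `β` with
`λ(h_β) = k + 1`, `μ(h_β) = k - 1`, such that `(x_β⁻ ⊗ t ^ k) w ≠ 0` while the corresponding
vectors vanish for the positive roots of smaller height. -/
structure MinimalData (b : (rootSystem H).Base) (lam mu : weightLattice H) (w : M) (β : H.root)
    (x : 𝔤) (k : ℕ) : Prop where
  symm : HasSymmPairing (rootSystem H)
  rel : SatisfiesRelations b lam mu w
  cyclic : ∀ v : M, ∃ u : UCurrent 𝔤, v = u • w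
  dom_left : IsDominant b lam
  dom_right : IsDominant b mu
  diff : ∀ α, b.IsPos α → |value lam α - value mu α| ≤ 2
  diff_simple : ∀ α ∈ b.support, |value lam α - value mu α| ≤ 1
  pos : b.IsPos β
  mem : x ∈ rootSpace H (-(β.1 : H → ℂ))
  left : value lam β = k + 1
  right : value mu β = k - 1
  ne_zero : cur x k • w ≠ 0
  low : ∀ α, b.IsPos α → b.height α < b.height β → ∀ y ∈ rootSpace H (-(α.1 : H → ℂ)), ∀ j : ℕ,
    value lam α + value mu α ≤ 2 * j → cur y j • w = 0

namespace MinimalData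

variable {β : H.root} {x : 𝔤} {k : ℕ}

omit [Module ℂ M] [IsScalarTower ℂ (UCurrent 𝔤) M] in
theorem x_ne_zero (D : MinimalData b lam mu w β x k) : x ≠ 0 := by
  rintro rfl
  exact D.ne_zero (by rw [cur_zero, zero_smul])

theorem value_of_add (D : MinimalData b lam mu w β x k) {α γ : H.root} (hα : b.IsPos α)
    (hγ : b.IsPos γ)
    (h : (rootSystem H).root β = (rootSystem H).root α + (rootSystem H).root γ) :
    value lam α = value mu α + 1 ∧ value lam γ = value mu γ + 1 := by
  have hht := b.height_add h
  rw [b.isPos_iff] at hα hγ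
  have h1 := value_of_root_add D.symm lam h
  have h2 := value_of_root_add D.symm mu h
  have hl := D.left
  have hr := D.right
  have d1 := abs_le.mp (D.diff α hα)
  have d2 := abs_le.mp (D.diff γ hγ)
  have p1 := D.dom_left.value_nonneg D.symm hα
  have p2 := D.dom_right.value_nonneg D.symm hα
  have p3 := D.dom_left.value_nonneg D.symm hγ
  have p4 := D.dom_right.value_nonneg D.symm hγ
  -- In the even case both halves are integers adding up to `k`, and the commutator of the two
  -- vanishing vectors contradicts `D.ne_zero`. In the odd case both differences are odd, at most 2
  -- in absolute value, and add up to 2.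
  rcases Int.even_or_odd' (value lam α + value mu α) with ⟨a, ha | ha⟩
  · exfalso
    lift a to ℕ using by omega
    obtain ⟨c, rfl⟩ : ∃ c, k = a + c := Nat.exists_eq_add_of_le (by omega)
    obtain ⟨y, hy, hy0⟩ := exists_ne_zero_mem_rootSpace_neg α
    obtain ⟨z, hz, hz0⟩ := exists_ne_zero_mem_rootSpace_neg γ
    have hx := cur_lie_smul_eq_zero (D.low α hα (by omega) y hy a (by omega))
      (D.low γ hγ (by omega) z hz c (by push_cast at hl hr; omega))
    obtain ⟨r, hr⟩ := exists_eq_smul_of_mem_rootSpace_neg β (lie_mem_rootSpace_neg h hy hz) D.mem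
      (lie_ne_zero_of_root_add D.symm h hy hz hy0 hz0)
    exact D.ne_zero (by rw [hr, cur_smul, smul_assoc, hx, smul_zero])
  · omega

omit [Module ℂ M] [IsScalarTower ℂ (UCurrent 𝔤) M] in
theorem ne_of_mem_support (D : MinimalData b lam mu w β x k) {i : H.root} (hi : i ∈ b.support) :
    β ≠ i := by
  rintro rfl
  have := abs_le.mp (D.diff_simple β hi)
  rw [D.left, D.right] at this
  omega

omit [Module ℂ M] [IsScalarTower ℂ (UCurrent 𝔤) M] in
theorem root_ne_neg (D : MinimalData b lam mu w β x k) {α : H.root} (hα : b.IsPos α) :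
    (rootSystem H).root β ≠ -(rootSystem H).root α := by
  intro h
  have h1 : α = (rootSystem H).reflectionPerm β β := by
    apply (rootSystem H).root.injective
    rw [(rootSystem H).root_reflectionPerm, (rootSystem H).reflection_apply_self, h, neg_neg]
  have h2 := b.height_reflectionPerm_self β
  have h3 := D.pos
  rw [b.isPos_iff] at hα h3
  change b.height ((rootSystem H).reflectionPerm β β) = _ at h2
  rw [← h1] at h2
  omega

theorem isDominant_sub (D : MinimalData b lam mu w β x k) :
    IsDominant b (lam - rootWeight β) := by
  intro i hi
  rw [value_sub, value_rootWeight]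
  have hpos := RootPairing.Base.isPos_of_mem_support hi
  have h0 := D.dom_left i hi
  rcases D.symm.pairingIn_mem (D.ne_of_mem_support hi) (D.root_ne_neg hpos) with h | h | h
  · omega
  · omega
  -- Here `β` minus the simple root is a positive root, so `lam` exceeds `mu` by 1 on the simple
  -- root and is at least 1 there.
  · obtain ⟨γ, hγ⟩ := (rootSystem H).root_sub_root_mem_of_pairingIn_pos (by rw [h]; exact one_pos)
      (D.ne_of_mem_support hi)
    have h1 := D.value_of_add (D.pos.sub hi hγ) hpos (by rw [hγ, sub_add_cancel])
    have h2 := D.dom_right i hi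
    omega

-- The bracket has weight `α - β`. It is a Cartan element in positive degree, a raising operator, or
-- a lowering operator for a root `γ` with `β = α + γ`. In the last case `γ` has smaller height and
-- minimality applies.
omit [Module ℂ M] [IsScalarTower ℂ (UCurrent 𝔤) M] in
theorem raising_smul (D : MinimalData b lam mu w β x k) {α : H.root} (hα : b.IsPos α) {y : 𝔤}
    (hy : y ∈ rootSpace H (α.1 : H → ℂ)) (r : ℕ) : cur y r • cur x k • w = 0 := by
  rw [cur_smul_cur_smul, D.rel.raising_smul hα hy, smul_zero, zero_add]
  have hm : ⁅y, x⁆ ∈ rootSpace H ((α.1 : H → ℂ) + -(β.1 : H → ℂ)) :=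
    lie_mem_genWeightSpace_of_mem_genWeightSpace hy D.mem
  have hk : k ≠ 0 := by
    have := D.dom_right.value_nonneg D.symm D.pos
    rw [D.right] at this
    omega
  by_cases hαβ : α = β
  · subst hαβ
    rw [add_neg_cancel, rootSpace_zero_eq] at hm
    exact D.rel.cartan_smul ⟨_, hm⟩ (by omega)
  have hχ : (α.1 : H → ℂ) + -(β.1 : H → ℂ) ≠ 0 := by
    intro h
    apply hαβ
    apply (rootSystem H).root.injective
    ext z
    exact congrFun (add_neg_eq_zero.mp h) z
  rcases eq_zero_or_exists_root hχ hm with h | ⟨δ, hδ⟩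
  · rw [h, cur_zero, zero_smul]
  rcases RootPairing.Base.IsPos.or_neg b δ with hp | hp
  · rw [← hδ] at hm
    exact D.rel.raising_smul hp hm _
  · change b.IsPos ((rootSystem H).reflectionPerm δ δ) at hp
    set γ := (rootSystem H).reflectionPerm δ δ with hγdef
    have hγδ : (rootSystem H).root γ = -(rootSystem H).root δ := by
      rw [hγdef, (rootSystem H).root_reflectionPerm, (rootSystem H).reflection_apply_self]
    have hγ : (γ.1 : H → ℂ) = -(δ.1 : H → ℂ) := by
      ext z
      exact LinearMap.congr_fun hγδ z
    have hβ : (rootSystem H).root β = (rootSystem H).root α + (rootSystem H).root γ := by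
      rw [root_eq_iff, hγ, hδ]
      abel
    rw [← hδ, ← neg_neg (δ.1 : H → ℂ), ← hγ] at hm
    have hht := b.height_add hβ
    have h1 := value_of_root_add D.symm lam hβ
    have h2 := value_of_root_add D.symm mu hβ
    have p1 := D.dom_left.value_nonneg D.symm hα
    have p2 := D.dom_right.value_nonneg D.symm hα
    have hl := D.left
    have hr := D.right
    rw [b.isPos_iff] at hα
    exact D.low γ hp (by omega) _ hm _ (by push_cast; omega)

theorem cartan_smul (D : MinimalData b lam mu w β x k) (h : H) (r : ℕ) :
    cur (h : 𝔤) r • cur x k • w =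
      algebraMap ℂ (UCurrent 𝔤) (if r = 0 then
        ((lam - rootWeight β + mu : weightLattice H) : Module.Dual ℂ H) h else 0) •
        cur x k • w := by
  rw [← mul_smul, cur_cartan_mul β D.mem, sub_smul, mul_smul, smul_assoc]
  split_ifs with hr
  · subst hr
    have h1 : ((lam - rootWeight β + mu : weightLattice H) : Module.Dual ℂ H) h =
        ((lam + mu : weightLattice H) : Module.Dual ℂ H) h - β.1 h := by
      have : ((rootWeight β : weightLattice H) : Module.Dual ℂ H) h = β.1 h := rfl
      simp only [AddSubgroup.coe_add, AddSubgroup.coe_sub, LinearMap.add_apply,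
        LinearMap.sub_apply, this]
      ring
    rw [D.rel.cartan_zero_smul, h1, map_sub, sub_smul, zero_add, ← mul_smul, ← Algebra.commutes,
      mul_smul, algebraMap_smul, algebraMap_smul]
  · have hk : cur x (r + k) • w = 0 := by
      have hl := D.left
      have hr := D.right
      exact D.rel.lowering_smul D.pos D.mem (by push_cast; omega) (by push_cast; omega)
    rw [D.rel.cartan_smul h hr, hk, smul_zero, smul_zero, sub_zero, map_zero, zero_smul]

theorem lowering_self_smul (D : MinimalData b lam mu w β x k) (hk : k ≠ 0) :
    cur x (k - 1) • cur x k • w = 0 := by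
  obtain ⟨j, rfl⟩ := Nat.exists_eq_succ_of_ne_zero hk
  have hl := D.left
  have hr := D.right
  push_cast at hl hr
  refine D.rel.cur_mul_succ_smul D.symm D.cyclic D.pos D.mem ?_ ?_
    (D.rel.lowering_smul D.pos D.mem ?_ ?_)
  all_goals (try rw [value_add]); push_cast; omega

/-- Write `x = [y, z]` up to a scalar. As `z ⊗ t ^ (c + 1)` kills `w` and the square of `y ⊗ t ^ a`
kills `w`, computing `y z y w` in two ways gives both `x y w` and `-(y x w)`. Since `x` and `y`
commute, `2 y x w = 0`. -/
theorem lowering_smul_of_add_right (D : MinimalData b lam mu w β x k) {α γ : H.root}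
    (hα : b.IsPos α) (hγ : b.IsPos γ)
    (h : (rootSystem H).root β = (rootSystem H).root α + (rootSystem H).root γ)
    {y : 𝔤} (hy : y ∈ rootSpace H (-(α.1 : H → ℂ))) {a : ℕ} (ha : value mu α = a) :
    cur y a • cur x k • w = 0 := by
  rcases eq_or_ne y 0 with rfl | hy0
  · rw [cur_zero, zero_smul]
  obtain ⟨z, hz, hz0⟩ := exists_ne_zero_mem_rootSpace_neg γ
  have hyz := lie_mem_rootSpace_neg h hy hz
  obtain ⟨r, rfl⟩ := exists_eq_smul_of_mem_rootSpace_neg β hyz D.mem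
    (lie_ne_zero_of_root_add D.symm h hy hz hy0 hz0)
  obtain ⟨h1, h2⟩ := D.value_of_add hα hγ h
  have h3 := value_of_root_add D.symm mu h
  have hr := D.right
  have p := D.dom_right.value_nonneg D.symm hγ
  obtain ⟨c, hc⟩ := Int.eq_ofNat_of_zero_le p
  obtain rfl : k = a + (c + 1) := by omega
  have hyyz : ⁅y, ⁅y, z⁆⁆ = 0 := by
    refine lie_eq_zero_of_pairingIn_nonneg D.symm ?_ hy hyz
    rw [D.symm, pairingIn_of_root_add h, (rootSystem H).pairingIn_same, D.symm,
      D.symm.pairingIn_eq_neg_one h]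
    norm_num
  have hyy : cur y a • cur y a • w = 0 := by
    refine D.rel.cur_mul_self_smul D.symm D.cyclic hα hy ?_ ?_ (D.rel.lowering_smul hα hy ?_ ?_)
    all_goals (try rw [value_add]); push_cast; omega
  have hzw : cur z (c + 1) • w = 0 :=
    D.rel.lowering_smul hγ hz (by push_cast; omega) (by push_cast; omega)
  have e1 := cur_smul_cur_smul y z a (c + 1) w
  rw [hzw, smul_zero] at e1
  have e2 := cur_smul_cur_smul y z a (c + 1) (cur y a • w)
  rw [hyy, smul_zero, zero_add, ← cur_smul_cur_smul_of_lie_eq_zero hyyz] at e2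
  have e3 := congrArg (fun v => cur y a • v) e1
  simp only [smul_zero, smul_add] at e3
  rw [e2, ← two_smul (UCurrent 𝔤), eq_comm] at e3
  rw [cur_smul, smul_assoc, ← algebraMap_smul (UCurrent 𝔤) r, ← mul_smul, ← Algebra.commutes,
    mul_smul, natCast_smul_eq_zero (A := UCurrent 𝔤) two_ne_zero e3, smul_zero]

theorem lowering_smul_of_add_left (D : MinimalData b lam mu w β x k) (hk : k ≠ 0) {α γ : H.root}
    (hα : b.IsPos α) (hγ : b.IsPos γ)
    (h : (rootSystem H).root α = (rootSystem H).root γ + (rootSystem H).root β)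
    (hlt : value mu α < value lam α)
    {y : 𝔤} (hy : y ∈ rootSpace H (-(α.1 : H → ℂ))) {m : ℕ} (hm : value lam α = m + 1) :
    cur y m • cur x k • w = 0 := by
  obtain ⟨z, hz, hz0⟩ := exists_ne_zero_mem_rootSpace_neg γ
  have hzx := lie_mem_rootSpace_neg h hz D.mem
  obtain ⟨r, rfl⟩ := exists_eq_smul_of_mem_rootSpace_neg α hzx hy
    (lie_ne_zero_of_root_add D.symm h hz D.mem hz0 D.x_ne_zero)
  suffices cur ⁅z, x⁆ m • cur x k • w = 0 by rw [cur_smul, smul_assoc, this, smul_zero]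
  have h1 := value_of_root_add D.symm lam h
  have h2 := value_of_root_add D.symm mu h
  have hl := D.left
  have hr := D.right
  have d := abs_le.mp (D.diff α hα)
  obtain ⟨c, hc⟩ := Int.eq_ofNat_of_zero_le (D.dom_left.value_nonneg D.symm hγ)
  obtain rfl : m = c + k := by omega
  -- The difference at `α` is 1 or 2, so the difference at `γ` is -1 or 0. In the case 0, expanding
  -- `z x x w = 0` gives twice the desired vector. In the case -1, `z` is only known to kill `w` one
  -- degree higher, which is compensated by using `x ⊗ t ^ (k - 1)` for one factor `x`.
  rcases (show value mu γ = c ∨ value mu γ = c + 1 by omega) with hc' | hc'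
  · have hzw : cur z c • w = 0 := D.rel.lowering_smul hγ hz (by omega) (by omega)
    have hxx : cur x k • cur x k • w = 0 := by
      refine D.rel.cur_mul_self_smul D.symm D.cyclic D.pos D.mem ?_ ?_
        (D.rel.lowering_smul D.pos D.mem ?_ ?_)
      all_goals (try rw [value_add]); push_cast; omega
    have hcomm : ⁅x, ⁅z, x⁆⁆ = 0 := by
      refine lie_eq_zero_of_pairingIn_nonneg D.symm ?_ D.mem hzx
      rw [D.symm, pairingIn_of_root_add h, (rootSystem H).pairingIn_same,
        D.symm.pairingIn_eq_neg_one h]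
      norm_num
    have e1 := cur_smul_cur_smul z x c k w
    rw [hzw, smul_zero, zero_add] at e1
    have e2 := cur_smul_cur_smul z x c k (cur x k • w)
    rw [hxx, smul_zero, e1, cur_smul_cur_smul_of_lie_eq_zero hcomm, ← two_smul (UCurrent 𝔤),
      eq_comm] at e2
    exact natCast_smul_eq_zero (A := UCurrent 𝔤) two_ne_zero e2
  · obtain ⟨j, rfl⟩ := Nat.exists_eq_succ_of_ne_zero hk
    have hzw : cur z (c + 1) • w = 0 :=
      D.rel.lowering_smul hγ hz (by push_cast; omega) (by push_cast; omega)
    have hxx := D.lowering_self_smul hk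
    rw [Nat.succ_sub_one] at hxx
    have e1 := cur_smul_cur_smul z x (c + 1) (j + 1) w
    rw [hzw, smul_zero, zero_add, D.rel.lowering_smul hα hzx (by push_cast at *; omega)
      (by push_cast at *; omega)] at e1
    have e2 := cur_smul_cur_smul z x (c + 1) j (cur x (j + 1) • w)
    rw [hxx, smul_zero, e1, smul_zero, zero_add, eq_comm] at e2
    rwa [show c + (j + 1) = c + 1 + j by omega]

theorem lowering_smul (D : MinimalData b lam mu w β x k) {α : H.root} (hα : b.IsPos α)
    {y : 𝔤} (hy : y ∈ rootSpace H (-(α.1 : H → ℂ))) {m : ℕ}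
    (hm : (m : ℤ) = max (value (lam - rootWeight β) α) (value mu α)) :
    cur y m • cur x k • w = 0 := by
  rw [value_sub, value_rootWeight] at hm
  have hk : k ≠ 0 := by
    have := D.dom_right.value_nonneg D.symm D.pos
    rw [D.right] at this
    omega
  have hl := D.left
  have hr := D.right
  by_cases hαβ : β = α
  · subst hαβ
    obtain ⟨r, rfl⟩ := exists_eq_smul_of_mem_rootSpace_neg β D.mem hy D.x_ne_zero
    rw [(rootSystem H).pairingIn_same] at hm
    rw [show m = k - 1 by omega, cur_smul, smul_assoc, D.lowering_self_smul hk, smul_zero]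
  rcases D.symm.pairingIn_mem hαβ (D.root_ne_neg hα) with h | h | h
  -- Pairing `-1`: subtracting `β` raises the bound for `α` by one on the left, which is enough room
  -- for the bracket with root `α + β`.
  · obtain ⟨γ, hγ⟩ := (rootSystem H).root_add_root_mem_of_pairingIn_neg (by rw [h]; norm_num)
      (D.root_ne_neg hα)
    rw [add_comm] at hγ
    have hyw : cur y m • w = 0 := D.rel.lowering_smul hα hy (by omega) (by omega)
    have h1 := value_of_root_add D.symm lam hγ
    have h2 := value_of_root_add D.symm mu hγ
    rw [cur_smul_cur_smul, hyw, smul_zero, zero_add]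
    exact D.rel.lowering_smul (hα.add D.pos hγ) (lie_mem_rootSpace_neg hγ hy D.mem)
      (by push_cast; omega) (by push_cast; omega)
  · have hyx : ⁅y, x⁆ = 0 :=
      lie_eq_zero_of_pairingIn_nonneg D.symm (by rw [D.symm, h]) hy D.mem
    rw [cur_smul_cur_smul_of_lie_eq_zero hyx,
      D.rel.lowering_smul hα hy (by omega) (by omega), smul_zero]
  · rcases le_or_gt (value lam α) (value mu α) with hle | hlt
    · have hyx : ⁅y, x⁆ = 0 :=
        lie_eq_zero_of_pairingIn_nonneg D.symm (by rw [D.symm, h]; norm_num) hy D.mem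
      rw [cur_smul_cur_smul_of_lie_eq_zero hyx,
        D.rel.lowering_smul hα hy (by omega) (by omega), smul_zero]
    -- The only delicate case: the required exponent is one below the exponent known to kill `w`.
    -- The root `β - α` may have either sign.
    · obtain ⟨δ, hδ⟩ := (rootSystem H).root_sub_root_mem_of_pairingIn_pos
        (by rw [h]; exact one_pos) hαβ
      rcases RootPairing.Base.IsPos.or_neg b δ with hp | hp
      · have hβ : (rootSystem H).root β = (rootSystem H).root α + (rootSystem H).root δ := by
          rw [hδ]; abel
        have := D.value_of_add hα hp hβ
        exact D.lowering_smul_of_add_right hα hp hβ hy (by omega)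
      · change b.IsPos ((rootSystem H).reflectionPerm δ δ) at hp
        refine D.lowering_smul_of_add_left hk hα hp ?_ hlt hy (by omega)
        rw [(rootSystem H).root_reflectionPerm, (rootSystem H).reflection_apply_self, hδ]
        abel

theorem satisfiesRelations (D : MinimalData b lam mu w β x k) :
    SatisfiesRelations b (lam - rootWeight β) mu (cur x k • w) := by
  intro u hu
  cases hu with
  | raising α hα y hy r => exact D.raising_smul hα hy r
  | cartan h r => rw [sub_smul, D.cartan_smul h r, sub_self]
  | integrable i hi y hy =>
    have hpos : 0 ≤ value (lam - rootWeight β + mu) i := by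
      rw [value_add]
      exact add_nonneg (D.isDominant_sub i hi) (D.dom_right i hi)
    obtain ⟨N, hN⟩ := Int.eq_ofNat_of_zero_le hpos
    rw [hN, Int.toNat_natCast]
    rcases eq_or_ne y 0 with rfl | hy0
    · rw [cur_zero, zero_pow N.succ_ne_zero, zero_smul]
    obtain ⟨e, he, hey⟩ := exists_lie_eq_coroot i hy hy0
    have hip := RootPairing.Base.isPos_of_mem_support hi
    obtain ⟨n, hn⟩ := D.rel.exists_pow_smul D.symm D.cyclic hip hy (cur x k • w)
    refine pow_succ_smul_eq_zero_of_sl2 (by rw [cur_mul_cur, hey]) (cur_coroot_mul i hy 0 0)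
      (D.raising_smul hip he 0) ?_ hn
    rw [D.cartan_smul, if_pos rfl, value_spec, hN, Int.cast_natCast, map_natCast]
  | lowering α hα y hy =>
    refine D.lowering_smul hα hy (Int.toNat_of_nonneg ?_)
    exact le_max_of_le_right (D.dom_right.value_nonneg D.symm hα)

end MinimalData

end CurrentAlg

/-! ### Euclidean realization of types A and D with a bounded vector `E`. -/

namespace CurrentAlg

section Realization

open scoped Matrix

/-- Partial sums of an alternating sequence of signs stay bounded. -/
theorem exists_bounded_partialSums {d : ℕ → ℤ} {N : ℕ} {e : ℚ}
    (hd : ∀ k, d k = -1 ∨ d k = 0 ∨ d k = 1)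
    (hpos : ∀ i j, i < N → i < j → d i = 1 → d j = 1 → ∃ s, i < s ∧ s < j ∧ d s ≠ 0)
    (hneg : ∀ i j, i < N → i < j → d i = -1 → d j = -1 → ∃ s, i < s ∧ s < j ∧ d s ≠ 0)
    (he : |e| ≤ 1)
    (hepos : 0 < e → ∃ j, N ≤ j ∧ d j = 1 ∧ ∀ k, N ≤ k → k < j → d k = 0)
    (heneg : e < 0 → ∃ j, N ≤ j ∧ d j = -1 ∧ ∀ k, N ≤ k → k < j → d k = 0) :
    ∃ E : ℕ → ℚ, E N = e ∧ (∀ i < N, E i - E (i + 1) = d i) ∧ ∀ i ≤ N, |E i| ≤ 1 := by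
  set E : ℕ → ℚ := fun i => e + ∑ k ∈ Finset.Ico i N, (d k : ℚ) with hE
  have hEN : E N = e := by simp [hE]
  have hstep : ∀ i < N, E i - E (i + 1) = d i := by
    intro i hi
    simp only [hE, Finset.sum_eq_sum_Ico_succ_bot hi]
    ring
  -- The invariant also says that a nonzero partial sum has the sign of the next nonzero `d j`.
  -- Adding a nonzero `d i` then moves the sum towards zero or starts from zero, since nonzero signs
  -- alternate.
  have inv : ∀ i ≤ N, |E i| ≤ 1 ∧
      (0 < E i → ∃ j, i ≤ j ∧ d j = 1 ∧ ∀ k, i ≤ k → k < j → d k = 0) ∧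
      (E i < 0 → ∃ j, i ≤ j ∧ d j = -1 ∧ ∀ k, i ≤ k → k < j → d k = 0) := by
    intro i hi
    refine Nat.decreasingInduction' (P := fun i => |E i| ≤ 1 ∧
      (0 < E i → ∃ j, i ≤ j ∧ d j = 1 ∧ ∀ k, i ≤ k → k < j → d k = 0) ∧
      (E i < 0 → ∃ j, i ≤ j ∧ d j = -1 ∧ ∀ k, i ≤ k → k < j → d k = 0)) ?_ hi
      (by rw [hEN]; exact ⟨he, hepos, heneg⟩)
    rintro i hiN - ⟨h1, h2, h3⟩
    have hs := hstep i hiN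
    rw [abs_le] at h1 ⊢
    rcases hd i with h | h | h
    · have hnn : 0 ≤ E (i + 1) := by
        by_contra hlt
        obtain ⟨j, hj, hdj, hz⟩ := h3 (not_le.mp hlt)
        obtain ⟨s, hs1, hs2, hs3⟩ := hneg i j hiN (by omega) h hdj
        exact hs3 (hz s (by omega) hs2)
      rw [h] at hs
      push_cast at hs
      refine ⟨⟨by linarith, by linarith⟩, fun hp => by linarith, fun _ => ⟨i, le_rfl, h, ?_⟩⟩
      intro k h1 h2
      omega
    · rw [h, Int.cast_zero, sub_eq_zero] at hs
      rw [hs]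
      refine ⟨h1, fun hp => ?_, fun hp => ?_⟩
      · obtain ⟨j, hj, hdj, hz⟩ := h2 hp
        refine ⟨j, by omega, hdj, fun k hk1 hk2 => ?_⟩
        rcases hk1.eq_or_lt with rfl | hk
        · exact h
        · exact hz k hk hk2
      · obtain ⟨j, hj, hdj, hz⟩ := h3 hp
        refine ⟨j, by omega, hdj, fun k hk1 hk2 => ?_⟩
        rcases hk1.eq_or_lt with rfl | hk
        · exact h
        · exact hz k hk hk2
    · have hnn : E (i + 1) ≤ 0 := by
        by_contra hlt
        obtain ⟨j, hj, hdj, hz⟩ := h2 (not_le.mp hlt)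
        obtain ⟨s, hs1, hs2, hs3⟩ := hpos i j hiN (by omega) h hdj
        exact hs3 (hz s (by omega) hs2)
      rw [h] at hs
      push_cast at hs
      refine ⟨⟨by linarith, by linarith⟩, fun _ => ⟨i, le_rfl, h, ?_⟩, fun hp => by linarith⟩
      intro k h1 h2
      omega
  exact ⟨E, hEN, hstep, fun i hi => (inv i hi).1⟩

/-- Vectors `v i` whose Gram matrix is `C`, and a vector `E` with coordinates in `[-1, 1]` whose
inner products with them are `d`. -/
structure BoundedRealization {n : ℕ} (C : Matrix (Fin n) (Fin n) ℤ) (d : Fin n → ℤ) (m : ℕ)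
    (v : Fin n → Fin m → ℤ) (E : Fin m → ℚ) : Prop where
  gram : ∀ i j, C i j = v i ⬝ᵥ v j
  apply : ∀ i, (d i : ℚ) = ∑ l, (v i l : ℚ) * E l
  bound : ∀ l, |E l| ≤ 1

variable {n : ℕ} {a c : Fin n → ℤ}

/-- The simple roots are differences of consecutive unit vectors, so `E` is determined up to a
constant by its successive differences. The betweenness condition says nothing about the last two
nodes; therefore the coordinate before the last difference is set to 0 and the last one to minus
that difference, and `d` is cut off there. -/
theorem exists_boundedRealization_A (hn : 1 ≤ n) (ha : ∀ i, 0 ≤ a i) (hc : ∀ i, 0 ≤ c i)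
    (hac : ∀ i, a i + c i ≤ 1) (hl : HalfInterlacing a c) (hr : HalfInterlacing c a) :
    ∃ v E, BoundedRealization (CartanMatrix.A n) (fun i => a i - c i) (n + 1) v E := by
  set d : ℕ → ℤ := fun k => if h : k + 1 < n then a ⟨k, by omega⟩ - c ⟨k, by omega⟩ else 0
    with hd
  have key : ∀ {x y : Fin n → ℤ}, (∀ i, 0 ≤ x i) → (∀ i, 0 ≤ y i) → (∀ i, x i + y i ≤ 1) →
      HalfInterlacing x y → ∀ i j, (hi : i + 1 < n) → (hj : j + 1 < n) → i < j →
      x ⟨i, by omega⟩ - y ⟨i, by omega⟩ = 1 → x ⟨j, by omega⟩ - y ⟨j, by omega⟩ = 1 →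
      ∃ s : ℕ, ∃ h : s < n, i < s ∧ s < j ∧ y ⟨s, h⟩ = 1 ∧ x ⟨s, h⟩ = 0 := by
    intro x y hx hy hxy hh i j hi hj hij h1 h2
    have hi0 := hy ⟨i, by omega⟩
    have hj0 := hy ⟨j, by omega⟩
    have hi1 := hxy ⟨i, by omega⟩
    have hj1 := hxy ⟨j, by omega⟩
    obtain ⟨s, hs1, hs2, hs3⟩ := hh.between ⟨i, by omega⟩ ⟨j, by omega⟩ hij
      (fun h => by simp only at h; omega) (by omega) (by omega)
    exact ⟨s, s.2, hs1, hs2, hs3, by have := hx s; have := hxy s; simp only [Fin.eta]; omega⟩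
  obtain ⟨E, hEN, hE, hb⟩ := exists_bounded_partialSums (d := d) (N := n - 1) (e := 0)
    (by
      intro k
      simp only [hd]
      split_ifs with h
      · have := ha ⟨k, by omega⟩
        have := hc ⟨k, by omega⟩
        have := hac ⟨k, by omega⟩
        omega
      · omega)
    (by
      intro i j hi hij h1 h2
      simp only [hd] at h1 h2
      split_ifs at h1 h2 with hi' hj'
      · obtain ⟨s, h, h3, h4, h5, h6⟩ := key ha hc hac hl i j hi' hj' hij h1 h2
        exact ⟨s, h3, h4, by simp only [hd]; rw [dif_pos (by omega)]; omega⟩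
      all_goals omega)
    (by
      intro i j hi hij h1 h2
      simp only [hd] at h1 h2
      split_ifs at h1 h2 with hi' hj'
      · obtain ⟨s, h, h3, h4, h5, h6⟩ := key hc ha (fun i => by rw [add_comm]; exact hac i) hr
          i j hi' hj' hij (by omega) (by omega)
        exact ⟨s, h3, h4, by simp only [hd]; rw [dif_pos (by omega)]; omega⟩)
    (by simp) (fun h => absurd h (lt_irrefl _)) (fun h => absurd h (lt_irrefl _))
  refine ⟨fun i => Pi.single i.castSucc 1 - Pi.single i.succ 1, fun l =>
    if l.val < n then E l.val else
      -((a ⟨n - 1, by omega⟩ - c ⟨n - 1, by omega⟩ : ℤ) : ℚ), ?_, ?_, ?_⟩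
  · intro i j
    simp only [sub_dotProduct, single_one_dotProduct, Pi.sub_apply, Pi.single_apply,
      CartanMatrix.A, Matrix.of_apply, Fin.ext_iff, Fin.val_castSucc, Fin.val_succ]
    split_ifs <;> omega
  · intro i
    have h1 : ∀ F : Fin (n + 1) → ℚ,
        ∑ l, (((Pi.single i.castSucc 1 - Pi.single i.succ 1 : Fin (n + 1) → ℤ) l : ℤ) : ℚ) * F l =
          F i.castSucc - F i.succ := by
      intro F
      simp [Pi.single_apply, sub_mul, Finset.sum_sub_distrib]
    rw [h1]
    simp only [Fin.val_castSucc, Fin.val_succ]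
    rw [if_pos i.2]
    split_ifs with h
    · rw [hE i (by omega)]
      simp only [hd]
      rw [dif_pos h]
    · have h2 : i = ⟨n - 1, by omega⟩ := Fin.ext (by simp only; omega)
      rw [congrArg Fin.val h2, hEN, zero_sub, neg_neg]
      exact congrArg (fun t => ((a t - c t : ℤ) : ℚ)) h2
  · intro l
    split_ifs with h
    · exact hb _ (by omega)
    · have h1 := ha ⟨n - 1, by omega⟩
      have h2 := hc ⟨n - 1, by omega⟩
      have h3 := hac ⟨n - 1, by omega⟩
      rw [abs_neg]
      have : |a ⟨n - 1, by omega⟩ - c ⟨n - 1, by omega⟩| ≤ 1 := abs_le.mpr ⟨by omega, by omega⟩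
      exact_mod_cast this

/-- The two spin nodes are the difference and the sum of the last two unit vectors, so they fix the
last two coordinates as half the sum and half the difference of the spin values. The remaining
coordinates are partial sums started from the half sum. -/
theorem exists_boundedRealization_D (hn : 4 ≤ n) (ha : ∀ i, 0 ≤ a i) (hc : ∀ i, 0 ≤ c i)
    (hac : ∀ i, a i + c i ≤ 1) (hl : HalfInterlacing a c) (hr : HalfInterlacing c a) :
    ∃ v E, BoundedRealization (CartanMatrix.D n) (fun i => a i - c i) n v E := by
  set d : ℕ → ℤ := fun k => if h : k < n then a ⟨k, h⟩ - c ⟨k, h⟩ else 0 with hd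
  have hdn : ∀ i : Fin n, a i - c i = d i := fun i => by simp only [hd]; rw [dif_pos i.2]
  have hd1 : ∀ k, d k = -1 ∨ d k = 0 ∨ d k = 1 := by
    intro k
    simp only [hd]
    split_ifs with h
    · have := ha ⟨k, h⟩
      have := hc ⟨k, h⟩
      have := hac ⟨k, h⟩
      omega
    · omega
  have key : ∀ {x y : Fin n → ℤ}, (∀ i, 0 ≤ x i) → (∀ i, 0 ≤ y i) → (∀ i, x i + y i ≤ 1) →
      HalfInterlacing x y → ∀ i j, (hi : i + 2 < n) → (hj : j < n) → i < j →
      x ⟨i, by omega⟩ - y ⟨i, by omega⟩ = 1 → x ⟨j, hj⟩ - y ⟨j, hj⟩ = 1 →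
      ∃ s : ℕ, ∃ h : s < n, i < s ∧ s < j ∧ y ⟨s, h⟩ = 1 ∧ x ⟨s, h⟩ = 0 := by
    intro x y hx hy hxy hh i j hi hj hij h1 h2
    have hi0 := hy ⟨i, by omega⟩
    have hj0 := hy ⟨j, by omega⟩
    have hi1 := hxy ⟨i, by omega⟩
    have hj1 := hxy ⟨j, by omega⟩
    obtain ⟨s, hs1, hs2, hs3⟩ := hh.between ⟨i, by omega⟩ ⟨j, by omega⟩ hij
      (fun h => by simp only at h; omega) (by omega) (by omega)
    exact ⟨s, s.2, hs1, hs2, hs3, by have := hx s; have := hxy s; simp only [Fin.eta]; omega⟩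
  set p : Fin n := ⟨n - 2, by omega⟩ with hp
  set q : Fin n := ⟨n - 1, by omega⟩ with hq
  have hspin : (a p - c p) * (a q - c q) ≠ -1 := by
    have h1 := hl.last p q (by simp only [hp]; omega) (by simp only [hq]; omega)
    have h2 := hr.last p q (by simp only [hp]; omega) (by simp only [hq]; omega)
    have := ha p
    have := ha q
    have := hc p
    have := hc q
    have := hac p
    have := hac q
    intro h
    rcases Int.mul_eq_neg_one_iff_eq_one_or_neg_one.mp h with h | h <;> omega
  rw [hdn, hdn] at hspin
  simp only [hp, hq] at hspin
  obtain ⟨E, hEN, hE, hb⟩ := exists_bounded_partialSums (d := d) (N := n - 2)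
    (e := ((d (n - 1) : ℚ) + d (n - 2)) / 2) hd1
    (by
      intro i j hi hij h1 h2
      simp only [hd] at h1 h2
      split_ifs at h1 h2 with hi' hj'
      · obtain ⟨s, h, h3, h4, h5, h6⟩ := key ha hc hac hl i j (by omega) hj' hij h1 h2
        exact ⟨s, h3, h4, by simp only [hd]; rw [dif_pos (by omega)]; omega⟩
      all_goals omega)
    (by
      intro i j hi hij h1 h2
      simp only [hd] at h1 h2
      split_ifs at h1 h2 with hi' hj'
      · obtain ⟨s, h, h3, h4, h5, h6⟩ := key hc ha (fun i => by rw [add_comm]; exact hac i) hr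
          i j (by omega) hj' hij (by omega) (by omega)
        exact ⟨s, h3, h4, by simp only [hd]; rw [dif_pos (by omega)]; omega⟩)
    (by rcases hd1 (n - 1) with h | h | h <;> rcases hd1 (n - 2) with h' | h' | h' <;>
          rw [h, h'] <;> norm_num)
    (by
      intro h0
      rcases hd1 (n - 2) with h' | h' | h'
      · rcases hd1 (n - 1) with h | h | h
        · rw [h, h'] at h0; norm_num at h0
        · rw [h, h'] at h0; norm_num at h0
        · rw [h, h'] at hspin; norm_num at hspin
      · refine ⟨n - 1, by omega, ?_, fun k h1 h2 => by rw [show k = n - 2 by omega, h']⟩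
        rcases hd1 (n - 1) with h | h | h
        · rw [h, h'] at h0; norm_num at h0
        · rw [h, h'] at h0; norm_num at h0
        · exact h
      · exact ⟨n - 2, le_rfl, h', fun k h1 h2 => by omega⟩)
    (by
      intro h0
      rcases hd1 (n - 2) with h' | h' | h'
      · exact ⟨n - 2, le_rfl, h', fun k h1 h2 => by omega⟩
      · refine ⟨n - 1, by omega, ?_, fun k h1 h2 => by rw [show k = n - 2 by omega, h']⟩
        rcases hd1 (n - 1) with h | h | h
        · exact h
        · rw [h, h'] at h0; norm_num at h0
        · rw [h, h'] at h0; norm_num at h0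
      · rcases hd1 (n - 1) with h | h | h
        · rw [h, h'] at hspin; norm_num at hspin
        · rw [h, h'] at h0; norm_num at h0
        · rw [h, h'] at h0; norm_num at h0)
  refine ⟨fun i => if h : i.val + 1 < n then Pi.single i 1 - Pi.single ⟨i.val + 1, h⟩ 1
      else Pi.single p 1 + Pi.single q 1,
    fun l => if l.val + 1 < n then E l.val else ((d (n - 1) : ℚ) - d (n - 2)) / 2, ?_, ?_, ?_⟩
  · intro i j
    simp only [CartanMatrix.D, Matrix.of_apply]
    by_cases hi : i.val + 1 < n <;> by_cases hj : j.val + 1 < n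
    · simp only [dif_pos hi, dif_pos hj, sub_dotProduct, single_one_dotProduct, Pi.sub_apply,
        Pi.single_apply, Fin.ext_iff]
      split_ifs <;> omega
    · simp only [dif_pos hi, dif_neg hj, sub_dotProduct, single_one_dotProduct, Pi.add_apply,
        Pi.single_apply, Fin.ext_iff, hp, hq]
      split_ifs <;> omega
    · simp only [dif_neg hi, dif_pos hj, add_dotProduct, single_one_dotProduct, Pi.sub_apply,
        Pi.single_apply, Fin.ext_iff, hp, hq]
      split_ifs <;> omega
    · simp only [dif_neg hi, dif_neg hj, add_dotProduct, single_one_dotProduct, Pi.add_apply,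
        Pi.single_apply, Fin.ext_iff, hp, hq]
      split_ifs <;> omega
  · intro i
    rw [hdn]
    by_cases hi : i.val + 1 < n
    · have h1 : ∀ F : Fin n → ℚ,
          ∑ l, (((Pi.single i 1 - Pi.single ⟨i.val + 1, hi⟩ 1 : Fin n → ℤ) l : ℤ) : ℚ) * F l =
            F i - F ⟨i.val + 1, hi⟩ := by
        intro F
        simp [Pi.single_apply, sub_mul, Finset.sum_sub_distrib]
      simp only [dif_pos hi]
      rw [h1, if_pos hi]
      dsimp only
      split_ifs with h2
      · rw [hE i (by omega)]
      · rw [show i.val = n - 2 by omega, hEN]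
        ring
    · have h1 : ∀ F : Fin n → ℚ,
          ∑ l, (((Pi.single p 1 + Pi.single q 1 : Fin n → ℤ) l : ℤ) : ℚ) * F l = F p + F q := by
        intro F
        simp [Pi.single_apply, add_mul, Finset.sum_add_distrib]
      simp only [dif_neg hi]
      rw [h1]
      simp only [hp, hq]
      rw [if_pos (by omega), if_neg (by omega), hEN, show i.val = n - 1 by omega]
      ring
  · intro l
    split_ifs with h
    · exact hb _ (by omega)
    · rcases hd1 (n - 1) with h | h | h <;> rcases hd1 (n - 2) with h' | h' | h' <;>
        rw [h, h'] <;> norm_num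

end Realization

open LieAlgebra LieAlgebra.IsKilling
open scoped Matrix

/-! ### From simple roots to all roots. -/

section Pairing

variable {ι R M N : Type*} [Finite ι] [CommRing R] [CharZero R] [IsDomain R]
  [AddCommGroup M] [Module R M] [AddCommGroup N] [Module R N] {P : RootPairing ι R M N}
  [P.IsCrystallographic] [P.IsReduced]

omit [Finite ι] [IsDomain R] [P.IsReduced] in
theorem pairingIn_reflectionPerm_left (i j k : ι) :
    P.pairingIn ℤ (P.reflectionPerm j i) k =
      P.pairingIn ℤ i k - P.pairingIn ℤ i j * P.pairingIn ℤ j k := by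
  apply FaithfulSMul.algebraMap_injective ℤ R
  rw [map_sub, map_mul, P.algebraMap_pairingIn, P.algebraMap_pairingIn, P.algebraMap_pairingIn,
    P.algebraMap_pairingIn, ← P.root_coroot_eq_pairing, P.root_reflectionPerm,
    P.reflection_apply_root, map_sub, map_smul, LinearMap.sub_apply, LinearMap.smul_apply,
    P.root_coroot_eq_pairing, P.root_coroot_eq_pairing, smul_eq_mul]

/-- Every root is reached from simple ones by reflections, and the realization is transported by the
Euclidean reflections. The two pairing clauses are kept separate because symmetry is not yet known;
it is deduced from them. -/
theorem exists_vector_of_gram (b : P.Base) {κ : Type*} [Fintype κ] {v : b.support → κ → ℤ}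
    (hv : ∀ i j, b.cartanMatrix i j = v i ⬝ᵥ v j) (f : ι → ℤ) (E : κ → ℚ)
    (hf : ∀ i j, f (P.reflectionPerm j i) = f i - P.pairingIn ℤ j i * f j)
    (hE : ∀ i : b.support, (f i : ℚ) = ∑ l, (v i l : ℚ) * E l) (α : ι) :
    ∃ u : κ → ℤ, u ⬝ᵥ u = 2 ∧ (∀ j : b.support, P.pairingIn ℤ α j = u ⬝ᵥ v j) ∧
      (∀ j : b.support, P.pairingIn ℤ j α = u ⬝ᵥ v j) ∧ (f α : ℚ) = ∑ l, (u l : ℚ) * E l := by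
  have hv' : ∀ i j : b.support, P.pairingIn ℤ i j = v i ⬝ᵥ v j := hv
  refine b.induction_reflect α (p := fun α => ∃ u : κ → ℤ, u ⬝ᵥ u = 2 ∧
    (∀ j : b.support, P.pairingIn ℤ α j = u ⬝ᵥ v j) ∧
    (∀ j : b.support, P.pairingIn ℤ j α = u ⬝ᵥ v j) ∧ (f α : ℚ) = ∑ l, (u l : ℚ) * E l) ?_ ?_ ?_
  · rintro i ⟨u, h1, h2, h3, h4⟩
    refine ⟨-u, by simpa using h1, fun j => ?_, fun j => ?_, ?_⟩
    · rw [P.pairingIn_reflectionPerm_self_left, h2, neg_dotProduct]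
    · rw [P.pairingIn_reflectionPerm_self_right, h3, neg_dotProduct]
    · rw [hf, P.pairingIn_same]
      simp only [Pi.neg_apply, Int.cast_neg, neg_mul, Finset.sum_neg_distrib, ← h4]
      push_cast
      ring
  · intro i hi
    refine ⟨v ⟨i, hi⟩, ?_, hv' ⟨i, hi⟩, fun j => ?_, hE ⟨i, hi⟩⟩
    · rw [← hv', P.pairingIn_same]
    · rw [dotProduct_comm, ← hv']
  · rintro i j ⟨u, h1, h2, h3, h4⟩ hj
    have hjj : v ⟨j, hj⟩ ⬝ᵥ v ⟨j, hj⟩ = 2 := by rw [← hv', P.pairingIn_same]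
    have h2j := h2 ⟨j, hj⟩
    have h3j := h3 ⟨j, hj⟩
    simp only at h2j h3j
    refine ⟨u - (u ⬝ᵥ v ⟨j, hj⟩) • v ⟨j, hj⟩, ?_, fun k => ?_, fun k => ?_, ?_⟩
    · simp only [sub_dotProduct, dotProduct_sub, smul_dotProduct, dotProduct_smul, h1, hjj,
        dotProduct_comm (v ⟨j, hj⟩) u, smul_eq_mul]
      ring
    · rw [pairingIn_reflectionPerm_left, h2, h2j, sub_dotProduct, smul_dotProduct, ← hv',
        smul_eq_mul]
    · rw [P.pairingIn_reflectionPerm, pairingIn_reflectionPerm_left, h3, h3j, sub_dotProduct,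
        smul_dotProduct, dotProduct_comm (v ⟨j, hj⟩), ← hv', smul_eq_mul, mul_comm]
    · rw [hf, h3j]
      push_cast
      rw [h4, hE ⟨j, hj⟩]
      simp only [Pi.sub_apply, Pi.smul_apply, smul_eq_mul, Int.cast_sub, Int.cast_mul, sub_mul,
        Finset.sum_sub_distrib, Finset.mul_sum, mul_assoc]

theorem hasSymmPairing_of_gram (b : P.Base) {κ : Type*} [Fintype κ] {v : b.support → κ → ℤ}
    (hv : ∀ i j, b.cartanMatrix i j = v i ⬝ᵥ v j) : HasSymmPairing P := by
  intro α
  refine b.induction_reflect α (p := fun α => ∀ β, P.pairingIn ℤ α β = P.pairingIn ℤ β α) ?_ ?_ ?_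
  · intro i hi β
    rw [P.pairingIn_reflectionPerm_self_left, P.pairingIn_reflectionPerm_self_right, hi]
  · intro i hi β
    obtain ⟨u, -, h2, h3, -⟩ := exists_vector_of_gram b hv 0 0 (by simp) (by simp) β
    rw [h3 ⟨i, hi⟩, h2 ⟨i, hi⟩]
  · intro i j hi hj β
    rw [← P.pairingIn_reflectionPerm, hi, ← P.pairingIn_reflectionPerm]

/-- For an integer, the absolute value is at most the square. For a root vector the right-hand side
is 2. -/
theorem abs_sum_mul_le {κ : Type*} [Fintype κ] {u : κ → ℤ} {E : κ → ℚ} (hE : ∀ l, |E l| ≤ 1) :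
    |∑ l, (u l : ℚ) * E l| ≤ ((u ⬝ᵥ u : ℤ) : ℚ) := by
  rw [dotProduct, Int.cast_sum]
  refine (Finset.abs_sum_le_sum_abs _ _).trans (Finset.sum_le_sum fun l _ => ?_)
  rw [abs_mul]
  have h1 : |(u l : ℚ)| ≤ ((u l * u l : ℤ) : ℚ) := by
    have : |u l| ≤ u l * u l := by
      rw [← abs_mul_abs_self]
      have := abs_nonneg (u l)
      nlinarith
    exact_mod_cast this
  exact (mul_le_of_le_one_right (abs_nonneg _) (hE l)).trans h1

end Pairing

variable {𝔤 : Type*} [LieRing 𝔤] [LieAlgebra ℂ 𝔤] [FiniteDimensional ℂ 𝔤] [IsKilling ℂ 𝔤]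
  {H : LieSubalgebra ℂ 𝔤} [H.IsCartanSubalgebra]

theorem value_reflectionPerm (lam : weightLattice H) (i j : H.root) :
    value lam ((rootSystem H).reflectionPerm j i) =
      value lam i - (rootSystem H).pairingIn ℤ j i * value lam j := by
  have h1 := (rootSystem H).coroot_reflectionPerm j i
  rw [(rootSystem H).coreflection_apply_coroot, ← (rootSystem H).algebraMap_pairingIn ℤ,
    eq_intCast] at h1
  simp only [rootSystem_coroot_apply] at h1
  have h := value_spec lam ((rootSystem H).reflectionPerm j i)
  rw [h1, map_sub, map_smul, value_spec, value_spec, smul_eq_mul] at h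
  exact_mod_cast h.symm

theorem IsInterlacing.hasSymmPairing_and_abs_le {b : (rootSystem H).Base} {n : ℕ}
    {e : Fin n ≃ b.support} (htype : IsTypeAD b e) {lam₁ lam₂ : weightLattice H}
    (h₁ : IsDominant b lam₁) (h₂ : IsDominant b lam₂) (hint : IsInterlacing e lam₁ lam₂) :
    HasSymmPairing (rootSystem H) ∧ (∀ α, |value lam₁ α - value lam₂ α| ≤ 2) ∧
      ∀ α ∈ b.support, |value lam₁ α - value lam₂ α| ≤ 1 := by
  have ha : ∀ i, 0 ≤ value lam₁ (e i) := fun i => h₁ _ (e i).2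
  have hc : ∀ i, 0 ≤ value lam₂ (e i) := fun i => h₂ _ (e i).2
  have hac : ∀ i, value lam₁ (e i) + value lam₂ (e i) ≤ 1 := fun i => by
    rw [← value_add]; exact hint.sum_le_one i
  obtain ⟨C, m, v, E, hC, hB⟩ : ∃ (C : Matrix (Fin n) (Fin n) ℤ) (m : ℕ) (v : _) (E : _),
      (∀ i j, b.cartanMatrix (e i) (e j) = C i j) ∧ BoundedRealization C
        (fun i => value lam₁ (e i) - value lam₂ (e i)) m v E := by
    rcases htype with ⟨hn, hC⟩ | ⟨hn, hC⟩
    · obtain ⟨v, E, h⟩ := exists_boundedRealization_A hn ha hc hac hint.left hint.right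
      exact ⟨_, _, v, E, hC, h⟩
    · obtain ⟨v, E, h⟩ := exists_boundedRealization_D hn ha hc hac hint.left hint.right
      exact ⟨_, _, v, E, hC, h⟩
  have hv : ∀ i j, b.cartanMatrix i j = v (e.symm i) ⬝ᵥ v (e.symm j) := fun i j => by
    rw [← hB.gram, ← hC, e.apply_symm_apply, e.apply_symm_apply]
  refine ⟨hasSymmPairing_of_gram b hv, fun α => ?_, fun α hα => ?_⟩
  · obtain ⟨u, h1, -, -, h4⟩ := exists_vector_of_gram b hv (value (lam₁ - lam₂)) E
      (value_reflectionPerm _) (fun i => by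
        rw [← hB.apply (e.symm i), e.apply_symm_apply, value_sub]) α
    have h5 := abs_sum_mul_le (u := u) hB.bound
    rw [← h4, h1, value_sub] at h5
    exact_mod_cast h5
  · have h1 := ha (e.symm ⟨α, hα⟩)
    have h2 := hc (e.symm ⟨α, hα⟩)
    have h3 := hac (e.symm ⟨α, hα⟩)
    rw [e.apply_symm_apply] at h1 h2 h3
    simp only at h1 h2 h3
    exact abs_le.mpr ⟨by omega, by omega⟩

end CurrentAlg

/-! ### Universal property and reduction to the minimal situation. -/

namespace CurrentAlg

open LieAlgebra LieAlgebra.IsKilling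

variable {𝔤 : Type*} [LieRing 𝔤] [LieAlgebra ℂ 𝔤] [FiniteDimensional ℂ 𝔤] [IsKilling ℂ 𝔤]
  {H : LieSubalgebra ℂ 𝔤} [H.IsCartanSubalgebra]
  {M : Type*} [AddCommGroup M] [Module (UCurrent 𝔤) M] {b : (rootSystem H).Base}
  {lam mu : weightLattice H} {w : M}

theorem IsRelator.symm {u : UCurrent 𝔤} (h : IsRelator b lam mu u) : IsRelator b mu lam u := by
  cases h with
  | raising α hα x hx r => exact .raising α hα x hx r
  | cartan h r => rw [add_comm lam]; exact .cartan h r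
  | integrable i hi x hx => rw [add_comm lam]; exact .integrable i hi x hx
  | lowering α hα x hx => rw [max_comm]; exact .lowering α hα x hx

theorem SatisfiesRelations.symm (hw : SatisfiesRelations b lam mu w) :
    SatisfiesRelations b mu lam w :=
  fun u hu => hw u hu.symm

theorem satisfiesRelations_gen (b : (rootSystem H).Base) (lam mu : weightLattice H) :
    SatisfiesRelations b lam mu (gen b lam mu) := by
  intro u hu
  rw [gen, ← map_smul, smul_eq_mul, mul_one, Submodule.mkQ_apply, Submodule.Quotient.mk_eq_zero]
  exact Submodule.subset_span hu

theorem exists_eq_smul_gen (b : (rootSystem H).Base) (lam mu : weightLattice H)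
    (v : V b lam mu) : ∃ u : UCurrent 𝔤, v = u • gen b lam mu := by
  obtain ⟨u, rfl⟩ := (relIdeal b lam mu).mkQ_surjective v
  exact ⟨u, by rw [gen, ← map_smul, smul_eq_mul, mul_one]⟩

/-- The universal property of `V(λ, μ)`. -/
theorem SatisfiesRelations.exists_surjective (hw : SatisfiesRelations b lam mu w) :
    ∃ φ : V b lam mu →ₗ[UCurrent 𝔤] Submodule.span (UCurrent 𝔤) {w},
      Function.Surjective φ ∧ (φ (gen b lam mu) : M) = w := by
  have hle : relIdeal b lam mu ≤ LinearMap.ker (LinearMap.toSpanSingleton (UCurrent 𝔤)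
      (Submodule.span (UCurrent 𝔤) {w}) ⟨w, Submodule.mem_span_singleton_self w⟩) := by
    refine Submodule.span_le.mpr fun u hu => ?_
    rw [SetLike.mem_coe, LinearMap.mem_ker, LinearMap.toSpanSingleton_apply]
    exact Subtype.ext (hw u hu)
  refine ⟨(relIdeal b lam mu).liftQ _ hle, ?_, ?_⟩
  · rintro ⟨v, hv⟩
    obtain ⟨u, rfl⟩ := Submodule.mem_span_singleton.mp hv
    refine ⟨(relIdeal b lam mu).mkQ u, ?_⟩
    rw [Submodule.mkQ_apply, Submodule.liftQ_apply, LinearMap.toSpanSingleton_apply]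
    rfl
  · rw [gen, Submodule.mkQ_apply, Submodule.liftQ_apply, LinearMap.toSpanSingleton_apply, one_smul]

variable [Module ℂ M] [IsScalarTower ℂ (UCurrent 𝔤) M]

theorem MinimalData.of_minimal_height (hs : HasSymmPairing (rootSystem H))
    (rel : SatisfiesRelations b lam mu w) (cyclic : ∀ v : M, ∃ u : UCurrent 𝔤, v = u • w)
    (hlam : IsDominant b lam) (hmu : IsDominant b mu)
    (hdiff : ∀ α, |value lam α - value mu α| ≤ 2)
    (hdiff' : ∀ α ∈ b.support, |value lam α - value mu α| ≤ 1)
    {xm : H.root → 𝔤} (hxm : ∀ α, xm α ∈ rootSpace H (-(α.1 : H → ℂ))) (hxm0 : ∀ α, xm α ≠ 0)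
    {β : H.root} (hβ : b.IsPos β)
    (hne : cur (xm β) ⌈(value (lam + mu) β : ℚ) / 2⌉₊ • w ≠ 0)
    (hmin : ∀ α : H.root, b.IsPos α → cur (xm α) ⌈(value (lam + mu) α : ℚ) / 2⌉₊ • w ≠ 0 →
      b.height β ≤ b.height α)
    (hlt : value mu β < value lam β) :
    MinimalData b lam mu w β (xm β) ⌈(value (lam + mu) β : ℚ) / 2⌉₊ := by
  have hsum := value_add lam mu β
  have hge := le_two_mul_ceil_half (value (lam + mu) β)
  have hd := abs_le.mp (hdiff β)
  have hq := hmu.value_nonneg hs hβ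
  -- With difference 1 the rounded-up half sum equals the larger value, and the lowering relation
  -- kills the vector. The difference is therefore exactly 2.
  have hne1 : value lam β ≠ value mu β + 1 := fun h =>
    hne (rel.lowering_smul hβ (hxm β) (by omega) (by omega))
  have hle : ⌈(value (lam + mu) β : ℚ) / 2⌉₊ ≤ (value mu β + 1).toNat :=
    ceil_half_le (by omega)
  exact
  { symm := hs
    rel := rel
    cyclic := cyclic
    dom_left := hlam
    dom_right := hmu
    diff := fun α _ => hdiff α
    diff_simple := hdiff'
    pos := hβ
    mem := hxm β
    left := by omega
    right := by omega
    ne_zero := hne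
    low := by
      intro α hα hht y hy j hj
      have h0 : cur (xm α) ⌈(value (lam + mu) α : ℚ) / 2⌉₊ • w = 0 := by
        by_contra h
        exact absurd (hmin α hα h) (not_le.mpr hht)
      have h1 := rel.lowering_smul_of_le (hxm α) h0
        (ceil_half_le (v := value (lam + mu) α) (k := j) (by rw [value_add]; exact hj))
      obtain ⟨c, rfl⟩ := exists_eq_smul_of_mem_rootSpace_neg α (hxm α) hy (hxm0 α)
      rw [cur_smul, smul_assoc, h1, smul_zero] }

end CurrentAlg

end

open CurrentAlg LieAlgebra LieAlgebra.IsKilling in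
theorem mainTheorem6 {𝔤 : Type*} [LieRing 𝔤] [LieAlgebra ℂ 𝔤] [FiniteDimensional ℂ 𝔤]
    [IsSimple ℂ 𝔤] (H : LieSubalgebra ℂ 𝔤) [H.IsCartanSubalgebra]
    (b : (rootSystem H).Base) {n : ℕ} (e : Fin n ≃ b.support) (htype : IsTypeAD b e)
    -- `xm α` is a root vector `x_α⁻`
    (xm : H.root → 𝔤) (hxm : ∀ α, xm α ∈ rootSpace H (-(α.1 : H → ℂ))) (hxm0 : ∀ α, xm α ≠ 0)
    (lam₁ lam₂ nu : weightLattice H)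
    (hlam₁ : IsDominant b lam₁) (hlam₂ : IsDominant b lam₂) (hnu : IsDominant b nu)
    (hint : IsInterlacing e lam₁ lam₂)
    (nu₁ nu₂ : weightLattice H) (hnu₁ : nu₁ = lam₁ + nu) (hnu₂ : nu₂ = lam₂ + nu)
    (β : H.root) (hβ : b.IsPos β)
    (hne : midVector b nu₁ nu₂ β (xm β) ≠ 0)
    (hmin : ∀ α : H.root, b.IsPos α → midVector b nu₁ nu₂ α (xm α) ≠ 0 → b.height β ≤ b.height α) :
    (value nu₂ β < value nu₁ β →
      IsDominant b (nu₁ - rootWeight β) ∧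
      ∃ φ : V b (nu₁ - rootWeight β) nu₂ →ₗ[UCurrent 𝔤]
          Submodule.span (UCurrent 𝔤) {midVector b nu₁ nu₂ β (xm β)},
        Function.Surjective φ ∧
        (φ (gen b (nu₁ - rootWeight β) nu₂) : V b nu₁ nu₂) = midVector b nu₁ nu₂ β (xm β)) ∧
    (value nu₁ β < value nu₂ β →
      IsDominant b (nu₂ - rootWeight β) ∧
      ∃ φ : V b nu₁ (nu₂ - rootWeight β) →ₗ[UCurrent 𝔤]
          Submodule.span (UCurrent 𝔤) {midVector b nu₁ nu₂ β (xm β)},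
        Function.Surjective φ ∧
        (φ (gen b nu₁ (nu₂ - rootWeight β)) : V b nu₁ nu₂) = midVector b nu₁ nu₂ β (xm β)) := by
  obtain ⟨hs, hd, hd'⟩ := hint.hasSymmPairing_and_abs_le htype hlam₁ hlam₂
  -- The common summand `nu` cancels, so the bounds for the interlacing pair pass to the shifted
  -- pair.
  have hv : ∀ α, value nu₁ α - value nu₂ α = value lam₁ α - value lam₂ α := fun α => by
    rw [hnu₁, hnu₂, value_add, value_add]; ring
  have h1 : IsDominant b nu₁ := fun i hi => by
    rw [hnu₁, value_add]; exact add_nonneg (hlam₁ i hi) (hnu i hi)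
  have h2 : IsDominant b nu₂ := fun i hi => by
    rw [hnu₂, value_add]; exact add_nonneg (hlam₂ i hi) (hnu i hi)
  simp only [← hv] at hd hd'
  have hrel := satisfiesRelations_gen b nu₁ nu₂
  have hcyc := exists_eq_smul_gen b nu₁ nu₂
  constructor
  · intro hlt
    have D := MinimalData.of_minimal_height hs hrel hcyc h1 h2 hd hd' hxm hxm0 hβ hne hmin hlt
    exact ⟨D.isDominant_sub, D.satisfiesRelations.exists_surjective⟩
  · intro hlt
    simp only [midVector, add_comm nu₁ nu₂] at hne hmin
    have D := MinimalData.of_minimal_height hs hrel.symm hcyc h2 h1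
      (fun α => by rw [abs_sub_comm]; exact hd α) (fun α hα => by rw [abs_sub_comm]; exact hd' α hα)
      hxm hxm0 hβ hne hmin hlt
    have key := D.satisfiesRelations.symm.exists_surjective
    rw [add_comm nu₂ nu₁] at key
    exact ⟨D.isDominant_sub, key⟩
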